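/- For a spin $j\in\frac12\mathbb N=\{0,\frac12,1,\dots\}$ let $\mathcal H_j$ be the $(2j+1)$-dimensional irreducible unitary representation of $SU(2)$. For spins $j_1,\dots,j_n$ let $\mathrm{Inv}(\mathcal H_{j_1}\otimes\cdots\otimes\mathcal H_{j_n})$ be the subspace of $SU(2)$-invariant tensors. For spins $j,k,l$ that satisfy the triangle inequalities and $j+k+l\in\mathbb N$ let $C_j^{kl}:\mathcal H_j\to\mathcal H_k\otimes\mathcal H_l$ be the $SU(2)$-equivariant isometric embedding (unique up to a phase). **Theorem.** Let $\gamma\in\mathbb Q$, $n\in\mathbb N$, and let $k_1,\dots,k_n\in\frac12\mathbb N$ be such that $j_i^{\pm}:=\frac{|1\pm\gamma|}{2}\,k_i\in\frac12\mathbb N$ for all $i$, and $\sum_{i=1}^n j_i^+\in\mathbb N$. Let $P^\pm$ be the orthogonal projection of $\mathcal H_{j_1^\pm}\otimes\cdots\otimes\mathcal H_{j_n^\pm}$ onto $\mathrm{Inv}(\mathcal H_{j_1^\pm}\otimes\cdots\otimes\mathcal H_{j_n^\pm})$. Then the Engle–Pereira–Rovelli–Livine map $$\iota:\mathrm{Inv}(\mathcal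 H_{k_1}\otimes\cdots\otimes\mathcal H_{k_n})\to \mathrm{Inv}(\mathcal H_{j_1^+}\otimes\cdots\otimes\mathcal H_{j_n^+})\otimes \mathrm{Inv}(\mathcal H_{j_1^-}\otimes\cdots\otimes\mathcal H_{j_n^-}),$$ $$\iota(o)=(P^+\otimes P^-)\bigl(C_{k_1}^{j_1^+j_1^-}\otimes\cdots\otimes C_{k_n}^{j_n^+j_n^-}\bigr)(o)$$ (where the factors are reordered so that those with $j_i^+$ come first) is injective. -/

import Mathlib

noncomputable section

namespace EPRL

open scoped TensorProduct Kronecker Matrix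

/-! Spins are recorded by their doubles: a natural number `N` stands for the spin `N / 2`.
The spin-`N/2` space `H_{N/2}` is the space of binary forms of degree `N`, written in the
orthonormal basis `e_m = √(N choose m) x ^ m y ^ (N - m)`, `m = 0, …, N`; thus `H_{N/2}` is
`EuclideanSpace ℂ (Fin (N + 1))`. -/

/-- The matrix, in the orthonormal basis `e_m`, of the substitution
`x ↦ g₀₀ x + g₁₀ y`, `y ↦ g₀₁ x + g₁₁ y` on binary forms of degree `N` (with `y = 1`).
For `g ∈ SU(2)` this is the spin-`N/2` representation. -/
def spinMatrix (N : ℕ) (g : Matrix (Fin 2) (Fin 2) ℂ) :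
    Matrix (Fin (N + 1)) (Fin (N + 1)) ℂ :=
  fun m' m =>
    (√(N.choose m : ℝ) : ℂ) / (√(N.choose m' : ℝ) : ℂ) *
      ((Polynomial.C (g 0 0) * Polynomial.X + Polynomial.C (g 1 0)) ^ (m : ℕ) *
        (Polynomial.C (g 0 1) * Polynomial.X + Polynomial.C (g 1 1)) ^ (N - m)).coeff (m' : ℕ)

/-- The tensor product `H_{N₁/2} ⊗ ⋯ ⊗ H_{Nₙ/2}` in index notation: tensors are arrays
`o^{A₁ … Aₙ}`, and the products of basis vectors form an orthonormal basis. -/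
abbrev TensorSpace {n : ℕ} (N : Fin n → ℕ) : Type :=
  EuclideanSpace ℂ ((i : Fin n) → Fin (N i + 1))

/-- `Inv (H_{N₁/2} ⊗ ⋯ ⊗ H_{Nₙ/2})`: the tensors fixed by every `g ∈ SU(2)`, which acts by the
tensor product of the spin representations. -/
def Inv {n : ℕ} (N : Fin n → ℕ) : Submodule ℂ (TensorSpace N) where
  carrier := {o | ∀ g ∈ Matrix.specialUnitaryGroup (Fin 2) ℂ, ∀ A,
    ∑ B, (∏ i, spinMatrix (N i) g (A i) (B i)) * o B = o A}
  zero_mem' := by intro g _ A; simp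
  add_mem' := by
    intro o o' ho ho' g hg A
    simp only [PiLp.add_apply, mul_add, Finset.sum_add_distrib, ho g hg A, ho' g hg A]
  smul_mem' := by
    intro c o ho g hg A
    simp only [PiLp.smul_apply, smul_eq_mul, mul_left_comm _ c, ← Finset.mul_sum, ho g hg A]

/-- Unnormalised Clebsch–Gordan map `H_{N/2} → H_{K/2} ⊗ H_{L/2}`. With `a = (N + K - L) / 2`,
`b = (N + L - K) / 2`, `c = (K + L - N) / 2`, it sends a binary form `f` of degree `N = a + b` to
`(x y' - y x') ^ c` times the polarisation of `f` of bidegree `(a, b)` in `(x, y)`, `(x', y')`. -/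
def cgRaw (N K L : ℕ) : Matrix (Fin (K + 1) × Fin (L + 1)) (Fin (N + 1)) ℂ :=
  fun pq m =>
    (∑ i ∈ Finset.range ((K + L - N) / 2 + 1), ∑ s ∈ Finset.range ((N + K - L) / 2 + 1),
      ∑ t ∈ Finset.range ((N + L - K) / 2 + 1),
        if i + s = pq.1 ∧ ((K + L - N) / 2 - i) + t = pq.2 ∧ s + t = m then
          (-1 : ℂ) ^ ((K + L - N) / 2 - i) * (((K + L - N) / 2).choose i : ℂ) *
            (((N + K - L) / 2).choose s : ℂ) * (((N + L - K) / 2).choose t : ℂ)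
        else 0) /
      ((√(K.choose pq.1 : ℝ) : ℂ) * (√(L.choose pq.2 : ℝ) : ℂ) * (√(N.choose m : ℝ) : ℂ))

/-- The natural isometric embedding `C : H_{N/2} → H_{K/2} ⊗ H_{L/2}`, as a matrix
`C^{p q}_m`: the Clebsch–Gordan map divided by the norm of the image of `e_0`.
It is meaningful when `(N/2, K/2, L/2)` satisfies the triangle inequalities and has integral sum;
then it is isometric and `SU(2)`-equivariant, see `cg_isometry` and `cg_equivariant`. -/
def cg (N K L : ℕ) : Matrix (Fin (K + 1) × Fin (L + 1)) (Fin (N + 1)) ℂ :=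
  ((√(∑ pq, ‖cgRaw N K L pq 0‖ ^ 2) : ℝ) : ℂ)⁻¹ • cgRaw N K L

/-- The orthogonal projection of `H_{N₁/2} ⊗ ⋯ ⊗ H_{Nₙ/2}` onto its invariants. -/
def invProj {n : ℕ} (N : Fin n → ℕ) : TensorSpace N →ₗ[ℂ] Inv N :=
  ((Inv N).orthogonalProjectionOnto : TensorSpace N →L[ℂ] Inv N)

/-- The Engle–Pereira–Rovelli–Livine map for the spins `k i / 2`, `jp i / 2`, `jm i / 2`:
`ι(o) = ∑_{B⁺, B⁻} (∑_A o^A ∏ᵢ C_{Aᵢ}^{Bᵢ⁺ Bᵢ⁻}) P⁺(e_{B⁺}) ⊗ P⁻(e_{B⁻})`. -/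
def eprl {n : ℕ} (k jp jm : Fin n → ℕ) : Inv k →ₗ[ℂ] Inv jp ⊗[ℂ] Inv jm where
  toFun o := ∑ Bp : (i : Fin n) → Fin (jp i + 1), ∑ Bm : (i : Fin n) → Fin (jm i + 1),
    (∑ A : (i : Fin n) → Fin (k i + 1),
        (o : TensorSpace k) A * ∏ i, cg (k i) (jp i) (jm i) (Bp i, Bm i) (A i)) •
      (invProj jp (EuclideanSpace.single Bp 1) ⊗ₜ[ℂ] invProj jm (EuclideanSpace.single Bm 1))
  map_add' o o' := by
    simp only [Submodule.coe_add, PiLp.add_apply, add_mul, Finset.sum_add_distrib, add_smul]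
  map_smul' c o := by
    simp only [Submodule.coe_smul, PiLp.smul_apply, smul_eq_mul, mul_assoc, ← Finset.mul_sum,
      mul_smul, ← Finset.smul_sum, RingHom.id_apply]

/-! The remaining facts confirm that `spinMatrix` is a unitary representation of `SU(2)` and that
`cg` is an isometric intertwiner. -/

/-- The basis forms `e_m = √(N choose m) x ^ m y ^ (N - m)`, evaluated at `(x, y)`. -/
def basisForm (N : ℕ) (x y : ℂ) (m : Fin (N + 1)) : ℂ :=
  (√(N.choose m : ℝ) : ℂ) * x ^ (m : ℕ) * y ^ (N - m)

theorem sqrt_choose_ne_zero {N m : ℕ} (h : m ≤ N) : (√(N.choose m : ℝ) : ℂ) ≠ 0 := by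
  have : (0 : ℝ) < (N.choose m : ℝ) := by exact_mod_cast Nat.choose_pos h
  exact_mod_cast (Real.sqrt_pos.2 this).ne'

theorem sqrt_choose_mul_self (N m : ℕ) :
    (√(N.choose m : ℝ) : ℂ) * (√(N.choose m : ℝ) : ℂ) = (N.choose m : ℂ) := by
  rw [← Complex.ofReal_mul, Real.mul_self_sqrt (Nat.cast_nonneg _)]
  simp

theorem sum_coeff_hom (a b c d x y : ℂ) {N m : ℕ} (hm : m ≤ N) :
    ∑ i ∈ Finset.range (N + 1),
      ((Polynomial.C a * Polynomial.X + Polynomial.C b) ^ m *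
        (Polynomial.C c * Polynomial.X + Polynomial.C d) ^ (N - m)).coeff i * x ^ i * y ^ (N - i) =
      (a * x + b * y) ^ m * (c * x + d * y) ^ (N - m) := by
  have hl : ∀ u v : ℂ, (Polynomial.C u * Polynomial.X + Polynomial.C v).natDegree ≤ 1 :=
    fun u v => Polynomial.natDegree_linear_le
  have h1 := Polynomial.natDegree_pow_le_of_le m (hl a b)
  have h2 := Polynomial.natDegree_pow_le_of_le (N - m) (hl c d)
  rw [mul_one] at h1 h2
  set p := (Polynomial.C a * Polynomial.X + Polynomial.C b) ^ m with hp
  set q := (Polynomial.C c * Polynomial.X + Polynomial.C d) ^ (N - m) with hq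
  have hpq : (p * q).natDegree < N + 1 := by
    have := Polynomial.natDegree_mul_le (p := p) (q := q)
    omega
  by_cases hy : y = 0
  · subst hy
    rw [Finset.sum_eq_single_of_mem N (by simp)]
    · have e1 : p.coeff m = a ^ m := by
        have := Polynomial.coeff_pow_of_natDegree_le (m := m) (hl a b)
        simpa using this
      have e2 : q.coeff (N - m) = c ^ (N - m) := by
        have := Polynomial.coeff_pow_of_natDegree_le (m := N - m) (hl c d)
        simpa using this
      have e3 := Polynomial.coeff_mul_add_eq_of_natDegree_le h1 h2
      rw [Nat.add_sub_cancel' hm] at e3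
      rw [e3, e1, e2]
      simp only [mul_zero, add_zero, Nat.sub_self, pow_zero, mul_one, mul_pow]
      rw [← Nat.add_sub_cancel' hm, pow_add]
      simp only [Nat.add_sub_cancel' hm]
      ring
    · intro i hi hne
      have : N - i ≠ 0 := by simp at hi; omega
      simp [this]
  · have := Polynomial.eval_eq_sum_range' hpq (x / y)
    have h3 : ∀ i ∈ Finset.range (N + 1), (p * q).coeff i * x ^ i * y ^ (N - i) =
        y ^ N * ((p * q).coeff i * (x / y) ^ i) := by
      intro i hi
      have : y ^ N = y ^ i * y ^ (N - i) := by
        rw [← pow_add]; congr 1; simp at hi; omega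
      rw [this, div_pow]
      field_simp
    rw [Finset.sum_congr rfl h3, ← Finset.mul_sum, ← this, hp, hq]
    simp only [Polynomial.eval_mul, Polynomial.eval_pow, Polynomial.eval_add, Polynomial.eval_C,
      Polynomial.eval_X]
    have h4 : y ^ N = y ^ m * y ^ (N - m) := by rw [← pow_add]; congr 1; omega
    have h5 : ∀ u v : ℂ, u * x + v * y = y * (u * (x / y) + v) := by
      intro u v; field_simp
    rw [h5 a b, h5 c d, mul_pow, mul_pow, h4]
    ring

theorem sum_basisForm_spinMatrix (N : ℕ) (g : Matrix (Fin 2) (Fin 2) ℂ) (x y : ℂ)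
    (m : Fin (N + 1)) :
    ∑ m', basisForm N x y m' * spinMatrix N g m' m =
      basisForm N (g 0 0 * x + g 1 0 * y) (g 0 1 * x + g 1 1 * y) m := by
  have hm : (m : ℕ) ≤ N := Nat.lt_succ_iff.1 m.2
  have := sum_coeff_hom (g 0 0) (g 1 0) (g 0 1) (g 1 1) x y hm
  rw [basisForm, mul_assoc, ← this, Finset.mul_sum, Finset.sum_range]
  refine Finset.sum_congr rfl fun i _ => ?_
  have hi := sqrt_choose_ne_zero (Nat.lt_succ_iff.1 i.2)
  simp only [basisForm, spinMatrix]
  field_simp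

theorem sum_basisForm_basisForm (N : ℕ) (s t x y : ℂ) :
    ∑ m, basisForm N s t m * basisForm N x y m = (s * x + t * y) ^ N := by
  rw [add_pow, Finset.sum_range]
  refine Finset.sum_congr rfl fun m _ => ?_
  rw [← sqrt_choose_mul_self]
  simp only [basisForm, mul_pow]
  ring

theorem eq_zero_of_sum_basisForm {N : ℕ} {v : Fin (N + 1) → ℂ}
    (h : ∀ x, ∑ m, basisForm N x 1 m * v m = 0) : v = 0 := by
  let p : Polynomial ℂ := ∑ m : Fin (N + 1),
    Polynomial.monomial (m : ℕ) ((√(N.choose m : ℝ) : ℂ) * v m)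
  have hp : p = 0 := by
    apply Polynomial.funext
    intro x
    rw [Polynomial.eval_zero, ← h x, Polynomial.eval_finsetSum]
    refine Finset.sum_congr rfl fun m _ => ?_
    simp only [basisForm, Polynomial.eval_monomial, one_pow]
    ring
  funext m
  have h1 : p.coeff m = 0 := by rw [hp, Polynomial.coeff_zero]
  have h2 : p.coeff m = (√(N.choose m : ℝ) : ℂ) * v m := by
    simp [p, Polynomial.coeff_monomial, Fin.val_inj]
  rw [h2] at h1
  exact (mul_eq_zero.1 h1).resolve_left (sqrt_choose_ne_zero (Nat.lt_succ_iff.1 m.2))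

theorem spinMatrix_mul (N : ℕ) (g h : Matrix (Fin 2) (Fin 2) ℂ) :
    spinMatrix N (g * h) = spinMatrix N g * spinMatrix N h := by
  ext m' m
  rw [← sub_eq_zero]
  refine congrFun (eq_zero_of_sum_basisForm
    (v := fun m' => spinMatrix N (g * h) m' m - (spinMatrix N g * spinMatrix N h) m' m)
    fun x => ?_) m'
  simp only [mul_sub, Finset.sum_sub_distrib, sum_basisForm_spinMatrix, Matrix.mul_apply,
    Finset.mul_sum]
  rw [Finset.sum_comm]
  simp only [← mul_assoc, ← Finset.sum_mul, sum_basisForm_spinMatrix]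
  rw [sub_eq_zero]
  congr 1 <;> simp [Fin.sum_univ_two] <;> ring

theorem spinMatrix_one (N : ℕ) : spinMatrix N 1 = 1 := by
  ext m' m
  rw [← sub_eq_zero]
  refine congrFun (eq_zero_of_sum_basisForm
    (v := fun m' => spinMatrix N 1 m' m - (1 : Matrix _ _ ℂ) m' m) fun x => ?_) m'
  simp only [mul_sub, Finset.sum_sub_distrib, sum_basisForm_spinMatrix]
  simp [Matrix.one_apply]

theorem spinMatrix_transpose (N : ℕ) (g : Matrix (Fin 2) (Fin 2) ℂ) :
    spinMatrix N g.transpose = (spinMatrix N g).transpose := by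
  ext m' m
  rw [← sub_eq_zero]
  refine congrFun (eq_zero_of_sum_basisForm (v := fun m' => spinMatrix N g.transpose m' m -
    (spinMatrix N g).transpose m' m) fun x => ?_) m'
  simp only [mul_sub, Finset.sum_sub_distrib, sum_basisForm_spinMatrix]
  refine congrFun (eq_zero_of_sum_basisForm (v := fun m => basisForm N _ _ m -
    ∑ m', basisForm N x 1 m' * (spinMatrix N g).transpose m' m) fun s => ?_) m
  simp only [mul_sub, Finset.sum_sub_distrib, sum_basisForm_basisForm, Finset.mul_sum,
    Matrix.transpose_apply]
  rw [Finset.sum_comm]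
  have : ∀ i, ∑ j, basisForm N s 1 j * (basisForm N x 1 i * spinMatrix N g j i) =
      basisForm N x 1 i * ∑ j, basisForm N s 1 j * spinMatrix N g j i := by
    intro i
    rw [Finset.mul_sum]
    exact Finset.sum_congr rfl fun _ _ => by ring
  simp only [this, sum_basisForm_spinMatrix, sum_basisForm_basisForm]
  rw [sub_eq_zero]
  congr 1
  ring

theorem spinMatrix_conjTranspose (N : ℕ) (g : Matrix (Fin 2) (Fin 2) ℂ) :
    spinMatrix N g.conjTranspose = (spinMatrix N g).conjTranspose := by
  rw [Matrix.conjTranspose, Matrix.conjTranspose, ← spinMatrix_transpose]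
  ext m' m
  have h : ∀ p : Polynomial ℂ, ∀ i, star (p.coeff i) = (p.map (starRingEnd ℂ)).coeff i := by
    intro p i; rw [Polynomial.coeff_map]; rfl
  simp only [spinMatrix, Matrix.map_apply, star_mul', h, Polynomial.map_mul,
    Polynomial.map_pow, Polynomial.map_add, Polynomial.map_C, Polynomial.map_X,
    Matrix.transpose_apply]
  simp

/-- Coherent-state form of the Clebsch–Gordan map. -/
theorem sum_cgRaw (N K L : ℕ) (h1 : N ≤ K + L) (h2 : K ≤ N + L) (h3 : L ≤ N + K)
    (h4 : Even (N + K + L)) (x y x' y' s t : ℂ) :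
    ∑ p, ∑ q, ∑ m, basisForm K x y p * basisForm L x' y' q * basisForm N s t m *
      cgRaw N K L (p, q) m =
    (x * y' - y * x') ^ ((K + L - N) / 2) * (s * x + t * y) ^ ((N + K - L) / 2) *
      (s * x' + t * y') ^ ((N + L - K) / 2) := by
  obtain ⟨r, hr⟩ := h4
  obtain ⟨a, b, c, rfl, rfl, rfl⟩ : ∃ a b c, N = a + b ∧ K = a + c ∧ L = b + c :=
    ⟨(N + K - L) / 2, (N + L - K) / 2, (K + L - N) / 2, by omega, by omega, by omega⟩
  simp only [show (a + c + (b + c) - (a + b)) / 2 = c by omega,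
    show (a + b + (a + c) - (b + c)) / 2 = a by omega,
    show (a + b + (b + c) - (a + c)) / 2 = b by omega]
  have key : ∀ (p : Fin (a + c + 1)) (q : Fin (b + c + 1)) (m : Fin (a + b + 1)),
      basisForm (a + c) x y p * basisForm (b + c) x' y' q * basisForm (a + b) s t m *
        cgRaw (a + b) (a + c) (b + c) (p, q) m =
      ∑ i ∈ Finset.range (c + 1), ∑ j ∈ Finset.range (a + 1), ∑ l ∈ Finset.range (b + 1),
        if i + j = p ∧ (c - i) + l = q ∧ j + l = m then
          ((-1) ^ (c - i) * (c.choose i : ℂ) * (a.choose j : ℂ) * (b.choose l : ℂ)) *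
            (x ^ (i + j) * y ^ (a + c - (i + j))) *
            (x' ^ (c - i + l) * y' ^ (b + c - (c - i + l))) *
            (s ^ (j + l) * t ^ (a + b - (j + l))) else 0 := by
    intro p q m
    have hp := sqrt_choose_ne_zero (Nat.lt_succ_iff.1 p.2)
    have hq := sqrt_choose_ne_zero (Nat.lt_succ_iff.1 q.2)
    have hm := sqrt_choose_ne_zero (Nat.lt_succ_iff.1 m.2)
    simp only [cgRaw, show (a + c + (b + c) - (a + b)) / 2 = c by omega,
      show (a + b + (a + c) - (b + c)) / 2 = a by omega,
      show (a + b + (b + c) - (a + c)) / 2 = b by omega, basisForm]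
    have e : ∀ S u v w u1 u2 v1 v2 w1 w2 : ℂ, u ≠ 0 → v ≠ 0 → w ≠ 0 →
        u * u1 * u2 * (v * v1 * v2) * (w * w1 * w2) * (S / (u * v * w)) =
          (u1 * u2 * (v1 * v2) * (w1 * w2)) * S := by
      intros; field_simp
    rw [e _ _ _ _ _ _ _ _ _ _ hp hq hm]
    simp only [Finset.mul_sum]
    refine Finset.sum_congr rfl fun i _ => Finset.sum_congr rfl fun j _ =>
      Finset.sum_congr rfl fun l _ => ?_
    split_ifs with hc
    · obtain ⟨e1, e2, e3⟩ := hc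
      rw [e1, e2, e3]
      ring
    · simp
  simp only [key]
  have comm : ∀ F : ℕ → ℕ → ℕ → Fin (a + c + 1) → Fin (b + c + 1) → Fin (a + b + 1) → ℂ,
      ∑ p, ∑ q, ∑ m, ∑ i ∈ Finset.range (c + 1), ∑ j ∈ Finset.range (a + 1),
        ∑ l ∈ Finset.range (b + 1), F i j l p q m =
      ∑ i ∈ Finset.range (c + 1), ∑ j ∈ Finset.range (a + 1),
        ∑ l ∈ Finset.range (b + 1), ∑ p, ∑ q, ∑ m, F i j l p q m := by
    intro F
    have e1 : ∀ {ι : Type} [Fintype ι] (G : ℕ → ℕ → ℕ → ι → ℂ),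
        ∑ u, ∑ i ∈ Finset.range (c + 1), ∑ j ∈ Finset.range (a + 1),
          ∑ l ∈ Finset.range (b + 1), G i j l u =
        ∑ i ∈ Finset.range (c + 1), ∑ j ∈ Finset.range (a + 1),
          ∑ l ∈ Finset.range (b + 1), ∑ u, G i j l u := by
      intro ι _ G
      rw [Finset.sum_comm]
      refine Finset.sum_congr rfl fun i _ => ?_
      rw [Finset.sum_comm]
      refine Finset.sum_congr rfl fun j _ => ?_
      rw [Finset.sum_comm]
    simp only [e1]
  rw [comm]
  rw [sub_eq_add_neg, add_pow, add_pow, add_pow, Finset.sum_mul_sum, Finset.sum_mul]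
  refine Finset.sum_congr rfl fun i hi => ?_
  rw [Finset.sum_mul]
  refine Finset.sum_congr rfl fun j hj => ?_
  rw [Finset.mul_sum]
  refine Finset.sum_congr rfl fun l hl => ?_
  simp only [Finset.mem_range] at hi hj hl
  rw [Finset.sum_eq_single_of_mem (⟨i + j, by omega⟩ : Fin (a + c + 1)) (Finset.mem_univ _),
    Finset.sum_eq_single_of_mem (⟨c - i + l, by omega⟩ : Fin (b + c + 1)) (Finset.mem_univ _),
    Finset.sum_eq_single_of_mem (⟨j + l, by omega⟩ : Fin (a + b + 1)) (Finset.mem_univ _)]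
  · rw [if_pos ⟨rfl, rfl, rfl⟩,
      show a + c - (i + j) = (c - i) + (a - j) by omega,
      show b + c - (c - i + l) = i + (b - l) by omega,
      show a + b - (j + l) = (a - j) + (b - l) by omega]
    simp only [pow_add, mul_pow, neg_pow (y * x')]
    ring
  · intro m _ hne
    exact if_neg fun hc => hne (Fin.ext hc.2.2.symm)
  · intro q _ hne
    exact Finset.sum_eq_zero fun m _ => if_neg fun hc => hne (Fin.ext hc.2.1.symm)
  · intro p _ hne
    exact Finset.sum_eq_zero fun q _ => Finset.sum_eq_zero fun m _ =>
      if_neg fun hc => hne (Fin.ext hc.1.symm)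

/-- The coherent-state form, for vectors indexed by pairs. -/
theorem vecMul_cgRaw_dotProduct (N K L : ℕ) (h1 : N ≤ K + L) (h2 : K ≤ N + L) (h3 : L ≤ N + K)
    (h4 : Even (N + K + L)) (x y x' y' s t : ℂ) :
    ((fun pq : Fin (K + 1) × Fin (L + 1) => basisForm K x y pq.1 * basisForm L x' y' pq.2) ᵥ*
      cgRaw N K L) ⬝ᵥ basisForm N s t =
    (x * y' - y * x') ^ ((K + L - N) / 2) * (s * x + t * y) ^ ((N + K - L) / 2) *
      (s * x' + t * y') ^ ((N + L - K) / 2) := by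
  rw [← sum_cgRaw N K L h1 h2 h3 h4, ← Matrix.dotProduct_mulVec]
  simp only [dotProduct, Matrix.mulVec, Fintype.sum_prod_type, Finset.mul_sum]
  exact Finset.sum_congr rfl fun _ _ => Finset.sum_congr rfl fun _ _ =>
    Finset.sum_congr rfl fun _ _ => by ring

theorem vecMul_kronecker_spinMatrix (K L : ℕ) (g : Matrix (Fin 2) (Fin 2) ℂ) (x y x' y' : ℂ) :
    (fun pq : Fin (K + 1) × Fin (L + 1) => basisForm K x y pq.1 * basisForm L x' y' pq.2) ᵥ*
      (spinMatrix K g ⊗ₖ spinMatrix L g) =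
    fun pq => basisForm K (g 0 0 * x + g 1 0 * y) (g 0 1 * x + g 1 1 * y) pq.1 *
      basisForm L (g 0 0 * x' + g 1 0 * y') (g 0 1 * x' + g 1 1 * y') pq.2 := by
  funext pq
  simp only [← sum_basisForm_spinMatrix, Finset.sum_mul_sum, Matrix.vecMul, dotProduct,
    Fintype.sum_prod_type, Matrix.kroneckerMap_apply]
  exact Finset.sum_congr rfl fun _ _ => Finset.sum_congr rfl fun _ _ => by ring

theorem spinMatrix_mulVec (N : ℕ) (g : Matrix (Fin 2) (Fin 2) ℂ) (s t : ℂ) :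
    spinMatrix N g *ᵥ basisForm N s t =
      basisForm N (g 0 0 * s + g 0 1 * t) (g 1 0 * s + g 1 1 * t) := by
  funext m
  have := sum_basisForm_spinMatrix N g.transpose s t m
  rw [spinMatrix_transpose] at this
  simp only [Matrix.transpose_apply] at this
  rw [← this]
  simp only [Matrix.mulVec, dotProduct, mul_comm]

theorem cgRaw_equivariant (N K L : ℕ) (h1 : N ≤ K + L) (h2 : K ≤ N + L) (h3 : L ≤ N + K)
    (h4 : Even (N + K + L)) {g : Matrix (Fin 2) (Fin 2) ℂ} (hg : g.det = 1) :
    (spinMatrix K g ⊗ₖ spinMatrix L g) * cgRaw N K L = cgRaw N K L * spinMatrix N g := by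
  have hs := vecMul_cgRaw_dotProduct N K L h1 h2 h3 h4
  rw [Matrix.det_fin_two] at hg
  ext ⟨p, q⟩ m
  rw [← sub_eq_zero]
  set W := (spinMatrix K g ⊗ₖ spinMatrix L g) * cgRaw N K L - cgRaw N K L * spinMatrix N g with hW
  suffices hmain : ∀ x x' s, ∑ p, basisForm K x 1 p * ∑ q, basisForm L x' 1 q *
      ∑ m, basisForm N s 1 m * W (p, q) m = 0 by
    have i1 := fun x' s => congrFun (eq_zero_of_sum_basisForm (v := fun p => ∑ q,
      basisForm L x' 1 q * ∑ m, basisForm N s 1 m * W (p, q) m) fun x => hmain x x' s) p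
    have i2 := fun s => congrFun (eq_zero_of_sum_basisForm (v := fun q =>
      ∑ m, basisForm N s 1 m * W (p, q) m) fun x' => i1 x' s) q
    exact congrFun (eq_zero_of_sum_basisForm (v := fun m => W (p, q) m) fun s => i2 s) m
  intro x x' s
  have e : ∑ p, basisForm K x 1 p * ∑ q, basisForm L x' 1 q * ∑ m, basisForm N s 1 m * W (p, q) m =
      ((fun pq : Fin (K + 1) × Fin (L + 1) => basisForm K x 1 pq.1 * basisForm L x' 1 pq.2) ᵥ* W) ⬝ᵥ
        basisForm N s 1 := by
    rw [← Matrix.dotProduct_mulVec]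
    simp only [dotProduct, Matrix.mulVec, Fintype.sum_prod_type, Finset.mul_sum]
    exact Finset.sum_congr rfl fun _ _ => Finset.sum_congr rfl fun _ _ =>
      Finset.sum_congr rfl fun _ _ => by ring
  rw [e, hW, Matrix.vecMul_sub, sub_dotProduct, ← Matrix.vecMul_vecMul, ← Matrix.vecMul_vecMul,
    vecMul_kronecker_spinMatrix, ← Matrix.dotProduct_mulVec _ (spinMatrix N g), spinMatrix_mulVec,
    hs, hs, sub_eq_zero]
  congr 1
  · congr 1
    · congr 1
      linear_combination (x - x') * hg
    · congr 1
      ring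
  · congr 1
    ring

theorem cgRaw_eq_zero {N K L : ℕ} (p : Fin (K + 1)) (q : Fin (L + 1)) (m : Fin (N + 1))
    (h : (p : ℕ) + q ≠ m + (K + L - N) / 2) : cgRaw N K L (p, q) m = 0 := by
  have : ∀ i ∈ Finset.range ((K + L - N) / 2 + 1), ∀ s t : ℕ,
      ¬ (i + s = p ∧ ((K + L - N) / 2 - i) + t = q ∧ s + t = m) := by
    intro i hi s t hc
    simp only [Finset.mem_range] at hi
    omega
  rw [cgRaw, Finset.sum_eq_zero fun i hi => Finset.sum_eq_zero fun s _ =>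
    Finset.sum_eq_zero fun t _ => if_neg (this i hi s t), zero_div]

theorem cgRaw_norm_pos {N K L : ℕ} (h1 : N ≤ K + L) (h3 : L ≤ N + K) : 0 < ∑ pq, ‖cgRaw N K L pq 0‖ ^ 2 := by
  have hc : (K + L - N) / 2 < K + 1 := by omega
  refine Finset.sum_pos' (fun _ _ => by positivity)
    ⟨(⟨(K + L - N) / 2, hc⟩, 0), Finset.mem_univ _, ?_⟩
  suffices cgRaw N K L (⟨(K + L - N) / 2, hc⟩, 0) 0 ≠ 0 by positivity
  have hK := sqrt_choose_ne_zero (Nat.lt_succ_iff.1 hc)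
  simp only [cgRaw]
  rw [Finset.sum_eq_single_of_mem ((K + L - N) / 2) (by simp),
    Finset.sum_eq_single_of_mem 0 (by simp), Finset.sum_eq_single_of_mem 0 (by simp)]
  · simpa using hK
  · intro t _ ht
    exact if_neg fun h => ht (by simpa using h.2.2)
  · intro s _ hs
    refine Finset.sum_eq_zero fun t _ => if_neg fun h => hs ?_
    have := h.2.2
    simp at this
    exact this.1
  · intro i hi hne
    refine Finset.sum_eq_zero fun s _ => Finset.sum_eq_zero fun t _ => if_neg fun h => hne ?_
    have h5 := h.1
    have h6 := h.2.1
    simp at h5 h6 hi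
    omega

/-- The Clebsch–Gordan embedding intertwines the actions of `SU(2)`. -/
theorem cg_equivariant {N K L : ℕ} (h1 : N ≤ K + L) (h2 : K ≤ N + L) (h3 : L ≤ N + K)
    (h4 : Even (N + K + L)) {g : Matrix (Fin 2) (Fin 2) ℂ}
    (hg : g ∈ Matrix.specialUnitaryGroup (Fin 2) ℂ) :
    (spinMatrix K g ⊗ₖ spinMatrix L g) * cg N K L = cg N K L * spinMatrix N g := by
  rw [cg, Matrix.mul_smul, Matrix.smul_mul,
    cgRaw_equivariant N K L h1 h2 h3 h4 (Matrix.mem_specialUnitaryGroup_iff.1 hg).2]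

/-- The spin representation is unitary. -/
theorem spinMatrix_mem_unitaryGroup (N : ℕ) {g : Matrix (Fin 2) (Fin 2) ℂ}
    (hg : g ∈ Matrix.specialUnitaryGroup (Fin 2) ℂ) :
    spinMatrix N g ∈ Matrix.unitaryGroup (Fin (N + 1)) ℂ := by
  have h := Matrix.mem_unitaryGroup_iff.1 (Matrix.mem_specialUnitaryGroup_iff.1 hg).1
  rw [Matrix.mem_unitaryGroup_iff, Matrix.star_eq_conjTranspose, ← spinMatrix_conjTranspose,
    ← spinMatrix_mul, ← Matrix.star_eq_conjTranspose, h, spinMatrix_one]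

/-- The Clebsch–Gordan embedding is isometric. -/
theorem cg_isometry {N K L : ℕ} (h1 : N ≤ K + L) (h2 : K ≤ N + L) (h3 : L ≤ N + K)
    (h4 : Even (N + K + L)) : (cg N K L).conjTranspose * cg N K L = 1 := by
  set T := cgRaw N K L with hT
  have hcomm : ∀ g : Matrix (Fin 2) (Fin 2) ℂ, g.det = 1 →
      T.conjTranspose * T * spinMatrix N g = spinMatrix N g * (T.conjTranspose * T) := by
    intro g hg
    have e1 := cgRaw_equivariant N K L h1 h2 h3 h4 hg
    have hg' : g.conjTranspose.det = 1 := by rw [Matrix.det_conjTranspose, hg, star_one]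
    have e2 := congrArg Matrix.conjTranspose (cgRaw_equivariant N K L h1 h2 h3 h4 hg')
    rw [Matrix.conjTranspose_mul, Matrix.conjTranspose_mul, Matrix.conjTranspose_kronecker,
      spinMatrix_conjTranspose, spinMatrix_conjTranspose, spinMatrix_conjTranspose,
      Matrix.conjTranspose_conjTranspose, Matrix.conjTranspose_conjTranspose,
      Matrix.conjTranspose_conjTranspose] at e2
    rw [Matrix.mul_assoc, ← e1, ← Matrix.mul_assoc, e2, Matrix.mul_assoc]
  have hdiag : ∀ m m', m ≠ m' → (T.conjTranspose * T) m m' = 0 := by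
    intro m m' hne
    rw [Matrix.mul_apply]
    refine Finset.sum_eq_zero fun pq _ => ?_
    by_cases h : (pq.1 : ℕ) + pq.2 = m + (K + L - N) / 2
    · have : (pq.1 : ℕ) + pq.2 ≠ m' + (K + L - N) / 2 := by
        intro h'
        exact hne (Fin.ext (by omega))
      rw [hT, cgRaw_eq_zero pq.1 pq.2 m' this, mul_zero]
    · rw [Matrix.conjTranspose_apply, hT, cgRaw_eq_zero pq.1 pq.2 m h, star_zero,
        zero_mul]
  have h00 : (T.conjTranspose * T) 0 0 = ((∑ pq, ‖T pq 0‖ ^ 2 : ℝ) : ℂ) := by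
    rw [Matrix.mul_apply, Complex.ofReal_sum]
    refine Finset.sum_congr rfl fun pq _ => ?_
    rw [Matrix.conjTranspose_apply, Complex.ofReal_pow, ← Complex.conj_mul']
    rfl
  have hconst : ∀ m, (T.conjTranspose * T) m m = (T.conjTranspose * T) 0 0 := by
    intro m
    have e := congrFun (congrFun (hcomm !![0, 1; -1, 1] (by simp)) m) 0
    rw [Matrix.mul_apply, Matrix.mul_apply, Finset.sum_eq_single_of_mem m (Finset.mem_univ _)
      (fun i _ hi => by rw [hdiag m i hi.symm, zero_mul]),
      Finset.sum_eq_single_of_mem 0 (Finset.mem_univ _)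
      (fun i _ hi => by rw [hdiag i 0 hi, mul_zero]), mul_comm] at e
    have hne : spinMatrix N !![0, 1; -1, 1] m 0 ≠ 0 := by
      have hm := Nat.lt_succ_iff.1 m.2
      have h5 := sqrt_choose_ne_zero hm
      have h6 : ((N.choose m : ℕ) : ℂ) ≠ 0 := by exact_mod_cast (Nat.choose_pos hm).ne'
      simp [spinMatrix, Polynomial.coeff_X_add_one_pow, h6, h5]
    exact mul_left_cancel₀ hne e
  have hpos := cgRaw_norm_pos h1 h3
  have hTT : T.conjTranspose * T = ((∑ pq, ‖T pq 0‖ ^ 2 : ℝ) : ℂ) • (1 : Matrix _ _ ℂ) := by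
    ext m m'
    by_cases h : m = m'
    · subst h
      rw [hconst, h00]
      simp
    · rw [hdiag m m' h]
      simp [h]
  rw [cg, Matrix.conjTranspose_smul, Matrix.smul_mul, Matrix.mul_smul, ← hT, hTT, smul_smul, smul_smul]
  have hsq := Real.mul_self_sqrt hpos.le
  have hs0 := (Real.sqrt_pos.2 hpos).ne'
  have : star (((√(∑ pq, ‖T pq 0‖ ^ 2) : ℝ) : ℂ)⁻¹) * ((((√(∑ pq, ‖T pq 0‖ ^ 2) : ℝ) : ℂ)⁻¹) *
      ((∑ pq, ‖T pq 0‖ ^ 2 : ℝ) : ℂ)) = 1 := by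
    rw [star_inv₀, show star (((√(∑ pq, ‖T pq 0‖ ^ 2) : ℝ) : ℂ)) = ((√(∑ pq, ‖T pq 0‖ ^ 2) : ℝ) : ℂ)
      from Complex.conj_ofReal _]
    have hc : ((∑ pq, ‖T pq 0‖ ^ 2 : ℝ) : ℂ) = ((√(∑ pq, ‖T pq 0‖ ^ 2) : ℝ) : ℂ) *
        ((√(∑ pq, ‖T pq 0‖ ^ 2) : ℝ) : ℂ) := by
      rw [← Complex.ofReal_mul, hsq]
    have hz : ((√(∑ pq, ‖T pq 0‖ ^ 2) : ℝ) : ℂ) ≠ 0 := by exact_mod_cast hs0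
    rw [hc]
    field_simp
  rw [mul_assoc, this, one_smul]

end EPRL

end

/-! An invariant tensor is read as an SU(2)-invariant polynomial in vectors `(x_i, y_i)`,
multihomogeneous of multidegree `k`. The spins that occur are extremal: `k = jp + jm` if `|γ| ≤ 1`,
`jp = k + jm` if `γ > 1`, `jm = k + jp` if `γ < -1`. For extremal spins the Clebsch–Gordan
coefficients implement multiplication of polynomials. If `ι(o) = 0`, then pairing with `G ⊗ H` for
invariant `G`, `H` removes the projections and leaves a relation between `o`, `G` and `H`.

For `|γ| ≤ 1` the relation says that `o` is orthogonal to every product `G H`. So it suffices that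
such products span the invariants of multidegree `k`. Write `k = d • w`, `jp = e • w` with `e / d`
in lowest terms. Kempe's theorem (`invPoly_smul_le_pow`) says that invariants of multidegree `d • w`
are sums of `d`-fold products of invariants of multidegree `w`, provided `∑ w` is even; `e` of the
factors go to `G`, the rest to `H`. To prove it, expand an invariant in bracket monomials
(`mem_adjoin_bracket`), regarded as multigraphs; split the vertex `v` into `w v` copies of degree
`d`; make the graph bipartite by Plücker's relation; and peel off perfect matchings by Hall's
theorem.

For `|γ| > 1`, contract `o` with a nonzero invariant `H` in the smaller of the two target factors.
The result is the polynomial product `H o`, which is itself invariant and may serve as the other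
test vector. The relation becomes `‖H o‖² = 0`, and polynomial rings have no zero divisors. Kempe's
theorem also supplies `H`: a nonzero `o` forces a nonzero invariant of multidegree `w`, and `H` is a
power of it. -/

noncomputable section

namespace EPRL

open MvPolynomial
open scoped TensorProduct

/-! ### Brackets, Capelli's identity and the first fundamental theorem. -/

section Bracket

variable {V : Type*}

/-- Polynomials in the coordinates `(x_v, y_v) = (X (v, 0), X (v, 1))` of a family of vectors. -/
abbrev VecPoly (V : Type*) : Type _ := MvPolynomial (V × Fin 2) ℂ

/-- The bracket `[u v] = x_u y_v - y_u x_v`. -/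
def bracket (u v : V) : VecPoly V := X (u, 0) * X (v, 1) - X (u, 1) * X (v, 0)

theorem bracket_swap (u v : V) : bracket u v = -bracket v u := by
  simp only [bracket]; ring

theorem bracket_plucker (a b c d : V) :
    bracket a b * bracket c d = bracket a c * bracket b d - bracket a d * bracket b c := by
  simp only [bracket]; ring

theorem rename_bracket {W : Type*} (f : V → W) (u v : V) :
    rename (Prod.map f id) (bracket u v) = bracket (f u) (f v) := by
  simp [bracket]

/-- The derivation `∑ x_v ∂/∂y_v`. -/
def raise : Derivation ℂ (VecPoly V) (VecPoly V) :=
  mkDerivation ℂ fun p => if p.2 = 1 then X (p.1, 0) else 0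

/-- The derivation `∑ y_v ∂/∂x_v`. -/
def lower : Derivation ℂ (VecPoly V) (VecPoly V) :=
  mkDerivation ℂ fun p => if p.2 = 0 then X (p.1, 1) else 0

/-- The Euler derivation in the coordinates with second index `b`. -/
def euler (b : Fin 2) : Derivation ℂ (VecPoly V) (VecPoly V) :=
  mkDerivation ℂ fun p => if p.2 = b then X p else 0

@[simp] theorem raise_X (p : V × Fin 2) :
    raise (X p : VecPoly V) = if p.2 = 1 then X (p.1, 0) else 0 := mkDerivation_X ..

@[simp] theorem lower_X (p : V × Fin 2) :
    lower (X p : VecPoly V) = if p.2 = 0 then X (p.1, 1) else 0 := mkDerivation_X ..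

@[simp] theorem euler_X (b : Fin 2) (p : V × Fin 2) :
    euler b (X p : VecPoly V) = if p.2 = b then X p else 0 := mkDerivation_X ..

/-- The `sl₂` relation: what `raise` and `lower` both kill has weight zero, that is, equal degrees
in the `x` and in the `y` coordinates. -/
theorem lie_raise_lower :
    ⁅(raise : Derivation ℂ (VecPoly V) (VecPoly V)),
      (lower : Derivation ℂ (VecPoly V) (VecPoly V))⁆ = euler 0 - euler 1 := by
  refine derivation_ext fun p => ?_
  obtain ⟨v, b⟩ := p
  rw [Derivation.commutator_apply]
  fin_cases b <;> simp

theorem pderiv_comm (p q : V × Fin 2) (F : VecPoly V) :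
    pderiv p (pderiv q F) = pderiv q (pderiv p F) := by
  classical
  have : ⁅(pderiv p : Derivation ℂ (VecPoly V) (VecPoly V)),
      (pderiv q : Derivation ℂ (VecPoly V) (VecPoly V))⁆ = 0 := by
    refine derivation_ext fun r => ?_
    rw [Derivation.commutator_apply]
    simp [pderiv_X, Pi.single_apply, apply_ite]
  rw [← sub_eq_zero, ← Derivation.commutator_apply, this, Derivation.zero_apply]

theorem pderiv_raise (p : V × Fin 2) (F : VecPoly V) :
    pderiv p (raise F) = raise (pderiv p F) + if p.2 = 0 then pderiv (p.1, 1) F else 0 := by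
  classical
  have : ⁅(pderiv p : Derivation ℂ (VecPoly V) (VecPoly V)),
      (raise : Derivation ℂ (VecPoly V) (VecPoly V))⁆ =
      if p.2 = 0 then pderiv (p.1, 1) else 0 := by
    refine derivation_ext fun r => ?_
    obtain ⟨v, b⟩ := p
    obtain ⟨w, c⟩ := r
    rw [Derivation.commutator_apply]
    fin_cases b <;> fin_cases c <;> simp [pderiv_X, Pi.single_apply, apply_ite]
  have h := Derivation.commutator_apply (D1 := pderiv p) (D2 := raise) (a := F)
  rw [this] at h
  rw [← sub_eq_iff_eq_add', ← h]
  split_ifs <;> simp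

theorem pderiv_lower (p : V × Fin 2) (F : VecPoly V) :
    pderiv p (lower F) = lower (pderiv p F) + if p.2 = 1 then pderiv (p.1, 0) F else 0 := by
  classical
  have : ⁅(pderiv p : Derivation ℂ (VecPoly V) (VecPoly V)),
      (lower : Derivation ℂ (VecPoly V) (VecPoly V))⁆ =
      if p.2 = 1 then pderiv (p.1, 0) else 0 := by
    refine derivation_ext fun r => ?_
    obtain ⟨v, b⟩ := p
    obtain ⟨w, c⟩ := r
    rw [Derivation.commutator_apply]
    fin_cases b <;> fin_cases c <;> simp [pderiv_X, Pi.single_apply, apply_ite]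
  have h := Derivation.commutator_apply (D1 := pderiv p) (D2 := lower) (a := F)
  rw [this] at h
  rw [← sub_eq_iff_eq_add', ← h]
  split_ifs <;> simp

/-- Cayley's process: the bracket of the gradients at `u` and `v`. -/
def cayley (u v : V) (F : VecPoly V) : VecPoly V :=
  pderiv (u, 0) (pderiv (v, 1) F) - pderiv (u, 1) (pderiv (v, 0) F)

/-- Gradients transform like vectors, so their bracket is invariant: the two commutator terms of
`raise` with the partial derivatives cancel. This keeps the hypotheses of the first fundamental
theorem alive in its induction. -/
theorem raise_cayley (u v : V) {F : VecPoly V} (h : raise F = 0) : raise (cayley u v F) = 0 := by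
  have h0 : ∀ w : V, raise (pderiv (w, 0) F) = - pderiv (w, 1) F := by
    intro w
    have := pderiv_raise (w, 0) F
    rw [h, map_zero] at this
    simpa using eq_neg_of_add_eq_zero_left this.symm
  have h1 : ∀ w : V, raise (pderiv (w, 1) F) = 0 := by
    intro w
    have := pderiv_raise (w, 1) F
    rw [h, map_zero] at this
    simpa using this.symm
  have e1 := pderiv_raise (u, 0) (pderiv (v, 1) F)
  have e2 := pderiv_raise (u, 1) (pderiv (v, 0) F)
  rw [h1, map_zero] at e1
  rw [h0, map_neg] at e2
  simp only [if_true, Fin.isValue, one_ne_zero, if_false, add_zero] at e1 e2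
  rw [cayley, map_sub, ← e2, sub_neg_eq_add, ← e1]

theorem lower_cayley (u v : V) {F : VecPoly V} (h : lower F = 0) : lower (cayley u v F) = 0 := by
  have h0 : ∀ w : V, lower (pderiv (w, 1) F) = - pderiv (w, 0) F := by
    intro w
    have := pderiv_lower (w, 1) F
    rw [h, map_zero] at this
    simpa using eq_neg_of_add_eq_zero_left this.symm
  have h1 : ∀ w : V, lower (pderiv (w, 0) F) = 0 := by
    intro w
    have := pderiv_lower (w, 0) F
    rw [h, map_zero] at this
    simpa using this.symm
  have e1 := pderiv_lower (u, 1) (pderiv (v, 0) F)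
  have e2 := pderiv_lower (u, 0) (pderiv (v, 1) F)
  rw [h1, map_zero] at e1
  rw [h0, map_neg] at e2
  simp only [if_true, Fin.isValue, zero_ne_one, if_false, add_zero] at e1 e2
  rw [cayley, map_sub, ← e2, ← neg_add', add_comm, ← e1, neg_zero]

variable [Fintype V]

theorem raise_eq_sum (F : VecPoly V) : raise F = ∑ v, X (v, 0) * pderiv (v, 1) F := by
  classical
  have : (raise : Derivation ℂ (VecPoly V) (VecPoly V)) =
      ∑ v, (X (v, 0) : VecPoly V) • pderiv (v, 1) := by
    refine derivation_ext fun p => ?_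
    obtain ⟨w, c⟩ := p
    rw [← Derivation.coeFnAddMonoidHom_apply, ← Derivation.coeFnAddMonoidHom_apply, map_sum]
    fin_cases c <;> simp [Finset.sum_apply, pderiv_X, Pi.single_apply]
  rw [this, ← Derivation.coeFnAddMonoidHom_apply, map_sum]
  simp

theorem lower_eq_sum (F : VecPoly V) : lower F = ∑ v, X (v, 1) * pderiv (v, 0) F := by
  classical
  have : (lower : Derivation ℂ (VecPoly V) (VecPoly V)) =
      ∑ v, (X (v, 1) : VecPoly V) • pderiv (v, 0) := by
    refine derivation_ext fun p => ?_
    obtain ⟨w, c⟩ := p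
    rw [← Derivation.coeFnAddMonoidHom_apply, ← Derivation.coeFnAddMonoidHom_apply, map_sum]
    fin_cases c <;> simp [Finset.sum_apply, pderiv_X, Pi.single_apply]
  rw [this, ← Derivation.coeFnAddMonoidHom_apply, map_sum]
  simp

theorem euler_eq_sum (b : Fin 2) (F : VecPoly V) :
    euler b F = ∑ v, X (v, b) * pderiv (v, b) F := by
  classical
  have : (euler b : Derivation ℂ (VecPoly V) (VecPoly V)) =
      ∑ v, (X (v, b) : VecPoly V) • pderiv (v, b) := by
    refine derivation_ext fun p => ?_
    obtain ⟨w, c⟩ := p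
    rw [← Derivation.coeFnAddMonoidHom_apply, ← Derivation.coeFnAddMonoidHom_apply, map_sum]
    by_cases h : c = b <;> simp [Finset.sum_apply, pderiv_X, Pi.single_apply, h]
  rw [this, ← Derivation.coeFnAddMonoidHom_apply, map_sum]
  simp

/-- Capelli's identity for pairs of vectors. -/
theorem sum_bracket_mul_cayley (F : VecPoly V) :
    ∑ u, ∑ v, bracket u v * cayley u v F =
      2 * (euler 0 (euler 1 F) - raise (lower F) + euler 0 F) := by
  have e1 : euler 0 (euler 1 F) =
      ∑ u, ∑ v, X (u, 0) * X (v, 1) * pderiv (u, 0) (pderiv (v, 1) F) := by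
    rw [euler_eq_sum 1, map_sum, Finset.sum_comm]
    refine Finset.sum_congr rfl fun v _ => ?_
    rw [Derivation.leibniz, euler_X, euler_eq_sum, if_neg (by simp)]
    simp only [smul_eq_mul, mul_zero, add_zero, Finset.mul_sum]
    exact Finset.sum_congr rfl fun u _ => by ring
  -- The extra Euler term arises because `raise` also differentiates the coefficient `X (v, 1)` of
  -- `lower`.
  have e2 : raise (lower F) =
      (∑ u, ∑ v, X (u, 0) * X (v, 1) * pderiv (u, 1) (pderiv (v, 0) F)) + euler 0 F := by
    rw [lower_eq_sum, map_sum, Finset.sum_comm, euler_eq_sum, ← Finset.sum_add_distrib]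
    refine Finset.sum_congr rfl fun v _ => ?_
    rw [Derivation.leibniz, raise_X, raise_eq_sum, if_pos rfl]
    simp only [smul_eq_mul, Finset.mul_sum]
    rw [mul_comm (pderiv _ _)]
    exact congrArg₂ _ (Finset.sum_congr rfl fun u _ => by ring) rfl
  have e3 : ∑ u, ∑ v, X (u, 1) * X (v, 0) * cayley u v F =
      -∑ u, ∑ v, X (u, 0) * X (v, 1) * cayley u v F := by
    rw [Finset.sum_comm, ← Finset.sum_neg_distrib]
    refine Finset.sum_congr rfl fun u _ => ?_
    rw [← Finset.sum_neg_distrib]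
    refine Finset.sum_congr rfl fun v _ => ?_
    rw [cayley, cayley, pderiv_comm (v, 0), pderiv_comm (v, 1)]
    ring
  simp only [bracket, sub_mul, Finset.sum_sub_distrib]
  rw [e3, e2, e1]
  simp only [cayley, mul_sub, Finset.sum_sub_distrib]
  ring

/-- First fundamental theorem of invariant theory for `SL(2)`. -/
theorem mem_adjoin_bracket {D : ℕ} {F : VecPoly V} (hF : F.IsHomogeneous D) (hr : raise F = 0)
    (hl : lower F = 0) :
    F ∈ Algebra.adjoin ℂ (Set.range fun p : V × V => bracket p.1 p.2) := by
  induction D using Nat.strong_induction_on generalizing F with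
  | _ D ih =>
  rcases Nat.eq_zero_or_pos D with rfl | hD
  · rw [← totalDegree_zero_iff_isHomogeneous, totalDegree_eq_zero_iff_eq_C] at hF
    rw [hF]
    exact Subalgebra.algebraMap_mem _ _
  -- Weight zero and total degree `D` make both Euler operators act as `D / 2`. Capelli's identity
  -- then writes a nonzero multiple of `F` as a sum of brackets times invariants of lower degree.
  have e0 : euler 0 F = euler 1 F := by
    have := congrArg (fun δ => δ F) (lie_raise_lower (V := V))
    simp only [Derivation.commutator_apply, hr, hl, map_zero, Derivation.sub_apply, sub_zero] at this
    exact (sub_eq_zero.1 this.symm)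
  have e1 : euler 0 F + euler 1 F = (D : ℂ) • F := by
    have := hF.sum_X_mul_pderiv
    rw [Fintype.sum_prod_type] at this
    simp only [Fin.sum_univ_two, Finset.sum_add_distrib] at this
    rw [euler_eq_sum, euler_eq_sum, this, Nat.cast_smul_eq_nsmul]
  have e2 : euler 0 F = ((D : ℂ) / 2) • F := by
    rw [← e0, ← two_smul ℂ] at e1
    rw [div_eq_inv_mul, ← smul_smul, ← e1, smul_smul]
    norm_num
  have e3 := sum_bracket_mul_cayley F
  rw [← e0, e2, hl, map_zero, Derivation.map_smul, e2, sub_zero, smul_smul, ← add_smul,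
    two_mul, ← two_smul ℂ, smul_smul] at e3
  have hc : ((2 : ℂ) * (D / 2 * (D / 2) + D / 2)) ≠ 0 := by
    have : (0 : ℝ) < 2 * (D / 2 * (D / 2) + D / 2) := by
      have : (0 : ℝ) < D := by exact_mod_cast hD
      positivity
    have h := Complex.ofReal_ne_zero.2 this.ne'
    push_cast at h
    exact h
  rw [← inv_smul_smul₀ hc F]
  refine Subalgebra.smul_mem _ ?_ _
  rw [← e3]
  refine Subalgebra.sum_mem _ fun u _ => Subalgebra.sum_mem _ fun v _ =>
    Subalgebra.mul_mem _ (Algebra.subset_adjoin ⟨(u, v), rfl⟩) ?_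
  -- Truncated subtraction is harmless at `D = 1`: second derivatives vanish, and zero is
  -- homogeneous of every degree.
  refine ih (D - 1 - 1) (by omega) ?_ (raise_cayley u v hr) (lower_cayley u v hl)
  exact hF.pderiv.pderiv.sub hF.pderiv.pderiv

end Bracket

/-! ### Bracket monomials as multigraphs. -/

section Graph

variable {V W : Type*}

/-- The monomial in brackets that belongs to a directed multigraph. -/
def graphMonomial (s : Multiset (V × V)) : VecPoly V := (s.map fun p => bracket p.1 p.2).prod

@[simp] theorem graphMonomial_zero : graphMonomial (0 : Multiset (V × V)) = 1 := rfl

@[simp] theorem graphMonomial_cons (p : V × V) (s : Multiset (V × V)) :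
    graphMonomial (p ::ₘ s) = bracket p.1 p.2 * graphMonomial s := by
  simp [graphMonomial]

theorem graphMonomial_add (s t : Multiset (V × V)) :
    graphMonomial (s + t) = graphMonomial s * graphMonomial t := by
  simp [graphMonomial]

theorem rename_graphMonomial (f : V → W) (s : Multiset (V × V)) :
    rename (Prod.map f id) (graphMonomial s) = graphMonomial (s.map (Prod.map f f)) := by
  rw [graphMonomial, map_multiset_prod, Multiset.map_map, graphMonomial, Multiset.map_map]
  congr 1
  refine Multiset.map_congr rfl fun p _ => ?_
  exact rename_bracket f p.1 p.2

variable [DecidableEq V] [DecidableEq W]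

/-- The degrees of the vertices of a multigraph. -/
def graphDegree (s : Multiset (V × V)) (v : V) : ℕ :=
  (s.map Prod.fst).count v + (s.map Prod.snd).count v

@[simp] theorem graphDegree_zero : graphDegree (0 : Multiset (V × V)) = 0 := by
  funext v; simp [graphDegree]

theorem graphDegree_cons (p : V × V) (s : Multiset (V × V)) :
    graphDegree (p ::ₘ s) = Pi.single p.1 1 + Pi.single p.2 1 + graphDegree s := by
  funext v
  simp only [graphDegree, Multiset.map_cons, Multiset.count_cons, Pi.add_apply, Pi.single_apply]
  ring

/-- The weights that define multidegrees. -/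
def vecWeight (p : V × Fin 2) : V → ℕ := Pi.single p.1 1

theorem isWeightedHomogeneous_bracket (u v : V) :
    (bracket u v).IsWeightedHomogeneous vecWeight (Pi.single u 1 + Pi.single v 1) :=
  ((isWeightedHomogeneous_X ℂ vecWeight (u, (0 : Fin 2))).mul
    (isWeightedHomogeneous_X ℂ vecWeight (v, (1 : Fin 2)))).sub
  ((isWeightedHomogeneous_X ℂ vecWeight (u, (1 : Fin 2))).mul
    (isWeightedHomogeneous_X ℂ vecWeight (v, (0 : Fin 2))))

theorem isWeightedHomogeneous_graphMonomial (s : Multiset (V × V)) :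
    (graphMonomial s).IsWeightedHomogeneous vecWeight (graphDegree s) := by
  induction s using Multiset.induction_on with
  | empty => simpa using isWeightedHomogeneous_one ℂ (vecWeight (V := V))
  | cons p s ih =>
    rw [graphMonomial_cons, graphDegree_cons]
    exact (isWeightedHomogeneous_bracket p.1 p.2).mul ih

/-- A multihomogeneous polynomial in the algebra of brackets is a combination of bracket monomials
of the same multidegree. -/
theorem mem_span_graphMonomial {F : VecPoly V} {k : V → ℕ}
    (hF : F ∈ Algebra.adjoin ℂ (Set.range fun p : V × V => bracket p.1 p.2))
    (hk : F.IsWeightedHomogeneous vecWeight k) :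
    F ∈ Submodule.span ℂ {G | ∃ s, graphDegree s = k ∧ graphMonomial s = G} := by
  -- The projection to multidegree `k` fixes `F` and either keeps or kills each bracket monomial.
  rw [← hk.weightedHomogeneousComponent_same]
  rw [← Subalgebra.mem_toSubmodule, Algebra.adjoin_eq_span] at hF
  have h := Submodule.mem_map_of_mem (f := weightedHomogeneousComponent vecWeight k) hF
  rw [Submodule.map_span] at h
  refine Submodule.span_le.2 ?_ h
  rintro _ ⟨G, hG, rfl⟩
  obtain ⟨m, hm, rfl⟩ := Submonoid.exists_multiset_of_mem_closure hG
  obtain ⟨s, rfl⟩ : ∃ s : Multiset (V × V), s.map (fun p => bracket p.1 p.2) = m := by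
    clear hF h hG
    induction m using Multiset.induction_on with
    | empty => exact ⟨0, rfl⟩
    | cons a m ih =>
      obtain ⟨s, rfl⟩ := ih fun y hy => hm y (Multiset.mem_cons_of_mem hy)
      obtain ⟨p, rfl⟩ := hm _ (Multiset.mem_cons_self _ _)
      exact ⟨p ::ₘ s, by simp⟩
  have hs := isWeightedHomogeneous_graphMonomial s
  rw [graphMonomial] at hs
  by_cases h : k = graphDegree s
  · subst h
    rw [hs.weightedHomogeneousComponent_same]
    exact Submodule.subset_span ⟨s, rfl, rfl⟩
  · rw [hs.weightedHomogeneousComponent_ne _ h]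
    exact Submodule.zero_mem _

/-- The degrees of the vertices of a multigraph can be distributed arbitrarily over the fibres of
a map. -/
theorem exists_graph_lift [Fintype V] (f : V → W) (s : Multiset (W × W)) (δ : V → ℕ)
    (h : ∀ w, ∑ v with f v = w, δ v = graphDegree s w) :
    ∃ t : Multiset (V × V), t.map (Prod.map f f) = s ∧ graphDegree t = δ := by
  -- Lifts one edge end: the fibre over `w₀` still has positive total degree, so some vertex in it
  -- can take the end.
  have pick : ∀ (δ : V → ℕ) (D : W → ℕ) (w₀ : W),
      (∀ w, ∑ v with f v = w, δ v = (Pi.single w₀ 1 + D : W → ℕ) w) →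
      ∃ (v₀ : V) (δ' : V → ℕ), f v₀ = w₀ ∧ δ = Pi.single v₀ 1 + δ' ∧
        ∀ w, ∑ v with f v = w, δ' v = D w := by
    intro δ D w₀ h
    obtain ⟨v₀, hv₀, hne⟩ : ∃ v ∈ Finset.univ.filter (fun v => f v = w₀), δ v ≠ 0 := by
      by_contra! hcon
      have := h w₀
      rw [Finset.sum_eq_zero hcon] at this
      simp at this
      omega
    have hle : δ = Pi.single v₀ 1 + (δ - Pi.single v₀ 1) := by
      funext v
      by_cases hv : v = v₀
      · subst hv; simp; omega
      · simp [hv]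
    simp only [Finset.mem_filter, Finset.mem_univ, true_and] at hv₀
    refine ⟨v₀, δ - Pi.single v₀ 1, hv₀, hle, fun w => ?_⟩
    have h2 := h w
    rw [hle] at h2
    simp only [Pi.add_apply, Finset.sum_add_distrib] at h2
    have : ∑ v with f v = w, (Pi.single v₀ 1 : V → ℕ) v = (Pi.single w₀ 1 : W → ℕ) w := by
      simp only [Pi.single_apply, Finset.sum_ite_eq', Finset.mem_filter, Finset.mem_univ,
        true_and, hv₀]
      simp only [eq_comm]
    rw [this] at h2
    exact Nat.add_left_cancel h2
  induction s using Multiset.induction_on generalizing δ with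
  | empty =>
    refine ⟨0, rfl, ?_⟩
    funext v
    have := h (f v)
    rw [graphDegree_zero, Pi.zero_apply, Finset.sum_eq_zero_iff] at this
    exact (this v (by simp)).symm
  | cons p s ih =>
    rw [graphDegree_cons, add_assoc] at h
    obtain ⟨v₁, δ₁, hv₁, rfl, h₁⟩ := pick _ _ _ h
    obtain ⟨v₂, δ₂, hv₂, rfl, h₂⟩ := pick _ _ _ h₁
    obtain ⟨t, ht, rfl⟩ := ih δ₂ h₂
    exact ⟨(v₁, v₂) ::ₘ t, by simp [ht, hv₁, hv₂], by rw [graphDegree_cons, add_assoc]⟩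

end Graph

/-! ### Straightening to bipartite graphs. -/

section Bipartite

variable {A B : Type*} [DecidableEq A] [DecidableEq B]

/-- The multigraph on `A ⊕ B` with the given edges from `A` to `B`. -/
def bipartiteGraph (t : Multiset (A × B)) : Multiset ((A ⊕ B) × (A ⊕ B)) :=
  t.map fun p => (Sum.inl p.1, Sum.inr p.2)

theorem graphDegree_bipartiteGraph_inl (t : Multiset (A × B)) (a : A) :
    graphDegree (bipartiteGraph t) (Sum.inl a) = (t.map Prod.fst).count a := by
  induction t using Multiset.induction_on with
  | empty => simp [bipartiteGraph]
  | cons p t ih =>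
    rw [bipartiteGraph] at ih
    rw [bipartiteGraph, Multiset.map_cons, graphDegree_cons, Pi.add_apply, ih, Multiset.map_cons,
      Multiset.count_cons, add_comm]
    simp [Pi.single_apply]

theorem graphDegree_bipartiteGraph_inr (t : Multiset (A × B)) (b : B) :
    graphDegree (bipartiteGraph t) (Sum.inr b) = (t.map Prod.snd).count b := by
  induction t using Multiset.induction_on with
  | empty => simp [bipartiteGraph]
  | cons p t ih =>
    rw [bipartiteGraph] at ih
    rw [bipartiteGraph, Multiset.map_cons, graphDegree_cons, Pi.add_apply, ih, Multiset.map_cons,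
      Multiset.count_cons, add_comm]
    simp [Pi.single_apply]

variable [Fintype A] [Fintype B]

/-- A multigraph whose two colour classes have the same total degree is a combination of bipartite
ones, by Plücker's relation. -/
theorem graphMonomial_mem_span_bipartite (s : Multiset ((A ⊕ B) × (A ⊕ B)))
    (hs : ∑ a, graphDegree s (Sum.inl a) = ∑ b, graphDegree s (Sum.inr b)) :
    graphMonomial s ∈ Submodule.span ℂ
      {G | ∃ t, graphDegree (bipartiteGraph t) = graphDegree s ∧
        graphMonomial (bipartiteGraph t : Multiset ((A ⊕ B) × (A ⊕ B))) = G} := by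
  set Sp : (A ⊕ B → ℕ) → Submodule ℂ (VecPoly (A ⊕ B)) := fun δ => Submodule.span ℂ
      {G | ∃ t, graphDegree (bipartiteGraph t) = δ ∧
        graphMonomial (bipartiteGraph t : Multiset ((A ⊕ B) × (A ⊕ B))) = G} with hSp
  have step : ∀ (a : A) (b : B) δ G, G ∈ Sp δ →
      bracket (Sum.inl a) (Sum.inr b) * G ∈
        Sp (Pi.single (Sum.inl a) 1 + Pi.single (Sum.inr b) 1 + δ) := by
    intro a b δ G hG
    have := Submodule.mem_map_of_mem
      (f := LinearMap.mulLeft ℂ (bracket (Sum.inl a : A ⊕ B) (Sum.inr b))) hG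
    rw [hSp, Submodule.map_span] at this
    refine Submodule.span_mono ?_ this
    rintro _ ⟨_, ⟨t, rfl, rfl⟩, rfl⟩
    exact ⟨(a, b) ::ₘ t, by simp [bipartiteGraph, graphDegree_cons], by simp [bipartiteGraph]⟩
  have cross : ∀ (p : (A ⊕ B) × (A ⊕ B)) (s' : Multiset ((A ⊕ B) × (A ⊕ B))),
      ∑ v, graphDegree (p ::ₘ s') (Sum.inl v) =
        (if p.1.isLeft then 1 else 0) + (if p.2.isLeft then 1 else 0) +
          ∑ v, graphDegree s' (Sum.inl v) ∧
      ∑ v, graphDegree (p ::ₘ s') (Sum.inr v) =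
        (if p.1.isRight then 1 else 0) + (if p.2.isRight then 1 else 0) +
          ∑ v, graphDegree s' (Sum.inr v) := by
    intro p s'
    simp only [graphDegree_cons, Pi.add_apply, Finset.sum_add_distrib]
    obtain ⟨p | p, q | q⟩ := p <;> simp [Pi.single_apply]
  change graphMonomial s ∈ Sp (graphDegree s)
  induction hn : s.card using Nat.strong_induction_on generalizing s with
  | _ n ih =>
  -- An edge between the two classes is set aside without disturbing the balance of degrees;
  -- swapping its ends costs only a sign.
  by_cases hmix : ∃ p ∈ s, p.1.isLeft ≠ p.2.isLeft
  · obtain ⟨p, hp, hne⟩ := hmix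
    obtain ⟨s', rfl⟩ := Multiset.exists_cons_of_mem hp
    have hc := cross p s'
    rw [Multiset.card_cons] at hn
    have IH := ih s'.card (by omega) s'
    rw [graphDegree_cons, graphMonomial_cons]
    obtain ⟨p | p, q | q⟩ := p
    · simp at hne
    · exact step p q _ _ (IH (by simp at hc; omega) rfl)
    · rw [bracket_swap, neg_mul, add_comm (Pi.single _ _)]
      exact Submodule.neg_mem _ (step q p _ _ (IH (by simp at hc; omega) rfl))
    · simp at hne
  push Not at hmix
  -- Mixed edges count once on each side, so equal totals force as many left-left edges as
  -- right-right ones. One of each can then be exchanged for mixed edges.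
  have hcount : ∀ s : Multiset ((A ⊕ B) × (A ⊕ B)),
      ∑ v, graphDegree s (Sum.inl v) + 2 * s.countP (fun p => p.1.isRight ∧ p.2.isRight) =
        ∑ v, graphDegree s (Sum.inr v) + 2 * s.countP (fun p => p.1.isLeft ∧ p.2.isLeft) := by
    intro s
    induction s using Multiset.induction_on with
    | empty => simp
    | cons p s ih =>
      rw [(cross p s).1, (cross p s).2, Multiset.countP_cons, Multiset.countP_cons]
      obtain ⟨p | p, q | q⟩ := p <;> simp <;> omega
  have hcs := hcount s
  rcases Multiset.empty_or_exists_mem s with rfl | ⟨r, hr⟩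
  · exact Submodule.subset_span ⟨0, by simp [bipartiteGraph], by simp [bipartiteGraph]⟩
  have hpos : 0 < s.countP (fun p => p.1.isLeft ∧ p.2.isLeft) ∨
      0 < s.countP (fun p => p.1.isRight ∧ p.2.isRight) := by
    have := hmix r hr
    simp only [Multiset.countP_pos]
    by_cases h : r.1.isLeft
    · exact Or.inl ⟨r, hr, h, this ▸ h⟩
    · refine Or.inr ⟨r, hr, by simpa using h, ?_⟩
      rw [this] at h
      simpa using h
  obtain ⟨p, hp, hp1, hp2⟩ : ∃ p ∈ s, p.1.isLeft ∧ p.2.isLeft := by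
    rw [← Multiset.countP_pos]; omega
  obtain ⟨q, hq, hq1, hq2⟩ : ∃ p ∈ s, p.1.isRight ∧ p.2.isRight := by
    rw [← Multiset.countP_pos]; omega
  obtain ⟨s', rfl⟩ := Multiset.exists_cons_of_mem hp
  obtain ⟨a | a, a' | a'⟩ := p
  swap; · simp at hp2
  swap; · simp at hp1
  swap; · simp at hp1
  obtain ⟨b | b, b' | b'⟩ := q
  · simp at hq1
  · simp at hq1
  · simp at hq2
  obtain ⟨s, rfl⟩ := Multiset.exists_cons_of_mem ((Multiset.mem_cons.1 hq).resolve_left (by simp))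
  have hc := cross (Sum.inl a, Sum.inl a') ((Sum.inr b, Sum.inr b') ::ₘ s)
  have hc' := cross (Sum.inr b, Sum.inr b') s
  simp only [Multiset.card_cons] at hn
  have IH := ih s.card (by omega) s (by simp at hc hc'; omega) rfl
  -- The two terms of Plücker's relation `[a a'][b b'] = [a b][a' b'] - [a b'][a' b]`.
  have m1 := step a b _ _ (step a' b' _ _ IH)
  have m2 := step a b' _ _ (step a' b _ _ IH)
  have d1 : graphDegree ((Sum.inl a, Sum.inl a') ::ₘ (Sum.inr b, Sum.inr b') ::ₘ s) =
      Pi.single (Sum.inl a) 1 + Pi.single (Sum.inr b) 1 +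
        (Pi.single (Sum.inl a') 1 + Pi.single (Sum.inr b') 1 + graphDegree s) := by
    simp only [graphDegree_cons]; abel
  have d2 : graphDegree ((Sum.inl a, Sum.inl a') ::ₘ (Sum.inr b, Sum.inr b') ::ₘ s) =
      Pi.single (Sum.inl a) 1 + Pi.single (Sum.inr b') 1 +
        (Pi.single (Sum.inl a') 1 + Pi.single (Sum.inr b) 1 + graphDegree s) := by
    simp only [graphDegree_cons]; abel
  rw [← d1] at m1
  rw [← d2] at m2
  have := Submodule.sub_mem _ m1 m2
  rw [graphMonomial_cons, graphMonomial_cons]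
  rwa [← mul_assoc, ← mul_assoc, ← sub_mul, ← bracket_plucker, mul_assoc] at this

end Bipartite

/-! ### Perfect matchings in regular bipartite multigraphs. -/

section Matching

variable {A : Type*} [DecidableEq A]

theorem sum_count_map {P : Type*} (t : Multiset P) (f : P → A) (S : Finset A) :
    ∑ a ∈ S, (t.map f).count a = (t.filter fun p => f p ∈ S).card := by
  induction t using Multiset.induction_on with
  | empty => simp
  | cons p t ih =>
    simp only [Multiset.map_cons, Multiset.count_cons, Finset.sum_add_distrib, ih,
      Finset.sum_ite_eq', Multiset.filter_cons]
    split_ifs <;> simp [add_comm]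

variable [Fintype A]

/-- A regular bipartite multigraph of positive degree contains a perfect matching. -/
theorem exists_perfect_matching {d : ℕ} (t : Multiset (A × A))
    (h1 : ∀ a, (t.map Prod.fst).count a = d + 1) (h2 : ∀ a, (t.map Prod.snd).count a = d + 1) :
    ∃ (σ : Equiv.Perm A) (t' : Multiset (A × A)),
      t = Finset.univ.val.map (fun a => (a, σ a)) + t' := by
  -- Hall's condition by double counting: the `(d + 1) |S|` edges that leave `S` are among the `(d +
  -- 1) |N|` edges that end in its neighbourhood `N`.
  have hall := (Finset.all_card_le_biUnion_card_iff_exists_injective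
    fun a : A => Finset.univ.filter fun b => (a, b) ∈ t).1 fun S => by
      set N := S.biUnion fun a : A => Finset.univ.filter fun b => (a, b) ∈ t with hN
      have e1 := sum_count_map t Prod.fst S
      have e2 := sum_count_map t Prod.snd N
      simp only [h1, h2, Finset.sum_const, smul_eq_mul] at e1 e2
      have : (t.filter fun p => p.1 ∈ S).card ≤ (t.filter fun p => p.2 ∈ N).card := by
        refine Multiset.card_le_card (Multiset.le_filter.2 ⟨Multiset.filter_le _ _, ?_⟩)
        intro p hp
        rw [Multiset.mem_filter] at hp
        exact Finset.mem_biUnion.2 ⟨p.1, hp.2, by simpa using hp.1⟩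
      rw [← e1, ← e2] at this
      exact Nat.le_of_mul_le_mul_right this d.succ_pos
  obtain ⟨f, hf, hft⟩ := hall
  have hb : Function.Bijective f := Finite.injective_iff_bijective.1 hf
  have hle : Finset.univ.val.map (fun a => (a, f a)) ≤ t := by
    rw [Multiset.le_iff_subset (Finset.univ.nodup.map fun a b h => (Prod.ext_iff.1 h).1)]
    intro p hp
    obtain ⟨a, -, rfl⟩ := Multiset.mem_map.1 hp
    simpa using hft a
  obtain ⟨t', rfl⟩ := Multiset.le_iff_exists_add.1 hle
  exact ⟨Equiv.ofBijective f hb, t', rfl⟩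

end Matching

/-! ### Invariant polynomials and Kempe's theorem. -/

section Invariant

variable {V : Type*}

/-- The substitution `x_v ↦ g₀₀ x_v + g₁₀ y_v`, `y_v ↦ g₀₁ x_v + g₁₁ y_v` for every vector. -/
def subst (g : Matrix (Fin 2) (Fin 2) ℂ) : VecPoly V →ₐ[ℂ] VecPoly V :=
  aeval fun p => C (g 0 p.2) * X (p.1, 0) + C (g 1 p.2) * X (p.1, 1)

theorem eval_subst (g : Matrix (Fin 2) (Fin 2) ℂ) (z : V × Fin 2 → ℂ) (F : VecPoly V) :
    eval z (subst g F) = eval (fun p => g 0 p.2 * z (p.1, 0) + g 1 p.2 * z (p.1, 1)) F := by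
  have : ((aeval z).comp (subst g) : VecPoly V →ₐ[ℂ] ℂ) =
      aeval fun p => g 0 p.2 * z (p.1, 0) + g 1 p.2 * z (p.1, 1) := by
    refine algHom_ext fun p => ?_
    simp [subst]
  have h := DFunLike.congr_fun this F
  simpa [aeval_eq_eval] using h

theorem subst_bracket (g : Matrix (Fin 2) (Fin 2) ℂ) (u v : V) :
    subst g (bracket u v) = C g.det * bracket u v := by
  simp only [subst, bracket, map_sub, map_mul, aeval_X, Matrix.det_fin_two]
  ring

variable [DecidableEq V]

/-- The `SU(2)`-invariant polynomials of multidegree `k`. -/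
def invPoly (k : V → ℕ) : Submodule ℂ (VecPoly V) where
  carrier := {F | F.IsWeightedHomogeneous vecWeight k ∧
    ∀ g ∈ Matrix.specialUnitaryGroup (Fin 2) ℂ, subst g F = F}
  zero_mem' := ⟨isWeightedHomogeneous_zero _ _ _, fun g _ => map_zero _⟩
  add_mem' := fun hF hG => ⟨hF.1.add hG.1, fun g hg => by rw [map_add, hF.2 g hg, hG.2 g hg]⟩
  smul_mem' := fun c F hF => ⟨(weightedHomogeneousSubmodule ℂ vecWeight k).smul_mem c hF.1,
    fun g hg => by rw [map_smul, hF.2 g hg]⟩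

theorem mem_invPoly {k : V → ℕ} {F : VecPoly V} :
    F ∈ invPoly k ↔ F.IsWeightedHomogeneous vecWeight k ∧
      ∀ g ∈ Matrix.specialUnitaryGroup (Fin 2) ℂ, subst g F = F := Iff.rfl

theorem one_mem_invPoly : (1 : VecPoly V) ∈ invPoly 0 :=
  ⟨isWeightedHomogeneous_one _ _, fun _ _ => map_one _⟩

theorem mul_mem_invPoly {k l : V → ℕ} {F G : VecPoly V} (hF : F ∈ invPoly k) (hG : G ∈ invPoly l) :
    F * G ∈ invPoly (k + l) :=
  ⟨hF.1.mul hG.1, fun g hg => by rw [map_mul, hF.2 g hg, hG.2 g hg]⟩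

theorem pow_mem_invPoly {k : V → ℕ} {F : VecPoly V} (hF : F ∈ invPoly k) (d : ℕ) :
    F ^ d ∈ invPoly (d • k) := by
  induction d with
  | zero => simpa using one_mem_invPoly
  | succ d ih => rw [pow_succ, succ_nsmul]; exact mul_mem_invPoly ih hF

theorem invPoly_pow_le (k : V → ℕ) (d : ℕ) : invPoly k ^ d ≤ invPoly (d • k) := by
  induction d with
  | zero =>
    rw [pow_zero, zero_smul, Submodule.one_eq_span, Submodule.span_le]
    simpa using one_mem_invPoly
  | succ d ih =>
    rw [pow_succ, succ_nsmul]
    exact Submodule.mul_le.2 fun F hF G hG => mul_mem_invPoly (ih hF) hG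

theorem bracket_mem_invPoly (u v : V) : bracket u v ∈ invPoly (Pi.single u 1 + Pi.single v 1) :=
  ⟨isWeightedHomogeneous_bracket u v, fun g hg => by
    rw [subst_bracket, (Matrix.mem_specialUnitaryGroup_iff.1 hg).2, C_1, one_mul]⟩

theorem graphMonomial_mem_invPoly (s : Multiset (V × V)) :
    graphMonomial s ∈ invPoly (graphDegree s) := by
  induction s using Multiset.induction_on with
  | empty => simpa using one_mem_invPoly
  | cons p s ih =>
    rw [graphMonomial_cons, graphDegree_cons]
    exact mul_mem_invPoly (bracket_mem_invPoly _ _) ih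

variable [Fintype V]

theorem hasDerivAt_eval {σ : Type*} [Fintype σ] (c : ℝ → σ → ℂ) (c' : σ → ℂ) (t : ℝ)
    (hc : ∀ p, HasDerivAt (fun t => c t p) (c' p) t) (F : MvPolynomial σ ℂ) :
    HasDerivAt (fun t => eval (c t) F) (∑ p, eval (c t) (pderiv p F) * c' p) t := by
  classical
  induction F using MvPolynomial.induction_on with
  | C a => simpa using hasDerivAt_const t a
  | add F G hF hG =>
    simp only [map_add, add_mul, Finset.sum_add_distrib]
    exact hF.add hG
  | mul_X F q hF =>
    simp only [map_mul, eval_X]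
    refine (hF.mul (hc q)).congr_deriv ?_
    simp only [Derivation.leibniz, pderiv_X, smul_eq_mul, map_add, map_mul, eval_X, add_mul,
      Finset.sum_add_distrib, Finset.sum_mul]
    rw [add_comm]
    congr 1
    · rw [Finset.sum_eq_single_of_mem q (Finset.mem_univ _)]
      · simp
      · intro p _ hp
        simp [hp.symm]
    · exact Finset.sum_congr rfl fun _ _ => by ring

/-- The matrix `M` with off-diagonal entries `b`, `a` has `M² = -1`, so this is the one-parameter
group `exp (t M) = cos t + M sin t`. It is differentiated at `t = 0` and also supplies quarter turns
at `t = π / 2`. -/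
theorem rotation_mem (a b : ℂ) (t : ℝ) (hb : b * star b = 1) (hab : a = - star b) :
    !![(Real.cos t : ℂ), b * Real.sin t; a * Real.sin t, (Real.cos t : ℂ)] ∈
      Matrix.specialUnitaryGroup (Fin 2) ℂ := by
  subst hab
  have h : (Real.cos t : ℂ) * Real.cos t + Real.sin t * Real.sin t = 1 := by
    have := Real.cos_sq_add_sin_sq t
    rw [pow_two, pow_two] at this
    exact_mod_cast this
  have hs : ∀ r : ℝ, star (r : ℂ) = r := Complex.conj_ofReal
  rw [Matrix.mem_specialUnitaryGroup_iff, Matrix.mem_unitaryGroup_iff]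
  constructor
  · ext i j
    fin_cases i <;> fin_cases j <;>
      simp only [Matrix.mul_apply, Fin.sum_univ_two, Matrix.star_apply, Matrix.of_apply,
        Matrix.cons_val', Matrix.cons_val_zero, Matrix.cons_val_one, star_mul', hs, star_neg,
        star_star, Fin.zero_eta, Fin.mk_one, Matrix.one_apply_eq, Fin.isValue,
        Matrix.cons_val_fin_one, ne_eq, zero_ne_one, one_ne_zero, not_false_eq_true,
        Matrix.one_apply_ne]
    · linear_combination h + (Real.sin t : ℂ) * Real.sin t * hb
    · ring
    · ring
    · linear_combination h + (Real.sin t : ℂ) * Real.sin t * hb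
  · rw [Matrix.det_fin_two_of]
    linear_combination h + (Real.sin t : ℂ) * Real.sin t * hb

omit [DecidableEq V] in
-- Obtained by differentiating the invariance of `F` along the rotations at `t = 0`.
theorem raise_lower_of_invariant {F : VecPoly V} (a b : ℂ) (hb : b * star b = 1)
    (hab : a = - star b) (hF : ∀ g ∈ Matrix.specialUnitaryGroup (Fin 2) ℂ, subst g F = F) :
    C b * raise F + C a * lower F = 0 := by
  refine MvPolynomial.funext fun z => ?_
  let g : ℝ → Matrix (Fin 2) (Fin 2) ℂ := fun t =>
    !![(Real.cos t : ℂ), b * Real.sin t; a * Real.sin t, (Real.cos t : ℂ)]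
  have hcos : HasDerivAt (fun t : ℝ => (Real.cos t : ℂ)) 0 0 := by
    simpa using (Real.hasDerivAt_cos 0).ofReal_comp
  have hsin : HasDerivAt (fun t : ℝ => (Real.sin t : ℂ)) 1 0 := by
    simpa using (Real.hasDerivAt_sin 0).ofReal_comp
  have h := hasDerivAt_eval
    (fun t (p : V × Fin 2) => g t 0 p.2 * z (p.1, 0) + g t 1 p.2 * z (p.1, 1))
    (fun p => if p.2 = 0 then a * z (p.1, 1) else b * z (p.1, 0)) 0 (by
      rintro ⟨v, c⟩
      fin_cases c
      · have := (hcos.mul_const (z (v, 0))).add ((hsin.const_mul a).mul_const (z (v, 1)))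
        rw [zero_mul, zero_add, mul_one] at this
        exact this
      · have := ((hsin.const_mul b).mul_const (z (v, 0))).add (hcos.mul_const (z (v, 1)))
        rw [zero_mul, add_zero, mul_one] at this
        exact this)
    F
  have h2 : (fun t => eval (fun p : V × Fin 2 =>
      g t 0 p.2 * z (p.1, 0) + g t 1 p.2 * z (p.1, 1)) F) = fun _ => eval z F := by
    funext t
    rw [← eval_subst, hF _ (rotation_mem a b t hb hab)]
  rw [h2] at h
  have h3 := h.unique (hasDerivAt_const (0 : ℝ) (eval z F))
  have h4 : (fun p : V × Fin 2 => g 0 0 p.2 * z (p.1, 0) + g 0 1 p.2 * z (p.1, 1)) = z := by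
    funext ⟨v, c⟩
    fin_cases c <;> simp [g]
  rw [h4, Fintype.sum_prod_type] at h3
  rw [raise_eq_sum, lower_eq_sum, map_zero, ← h3]
  simp only [map_add, map_mul, map_sum, eval_C, eval_X, Fin.sum_univ_two, Finset.mul_sum,
    Finset.sum_add_distrib]
  rw [add_comm]
  refine congrArg₂ _ (Finset.sum_congr rfl fun v _ => ?_) (Finset.sum_congr rfl fun v _ => ?_)
  · simp; ring
  · simp; ring

omit [DecidableEq V] in
-- The directions `b = 1` and `b = i` give `raise - lower` and `i (raise + lower)`, which span both
-- operators over `ℂ`.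
theorem raise_eq_zero_and_lower_eq_zero {F : VecPoly V}
    (hF : ∀ g ∈ Matrix.specialUnitaryGroup (Fin 2) ℂ, subst g F = F) :
    raise F = 0 ∧ lower F = 0 := by
  have h1 := raise_lower_of_invariant (-1) 1 (by simp) (by simp) hF
  have h2 := raise_lower_of_invariant Complex.I Complex.I (by simp) (by simp) hF
  rw [← mul_add, mul_eq_zero, C_eq_zero] at h2
  have h2 := h2.resolve_left Complex.I_ne_zero
  simp only [C_1, one_mul, C_neg, neg_mul] at h1
  have h3 : (2 : ℂ) • raise F = 0 := by
    rw [two_smul]; linear_combination h1 + h2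
  have h4 := (smul_eq_zero.1 h3).resolve_left two_ne_zero
  rw [h4, zero_add] at h2
  exact ⟨h4, h2⟩

theorem isHomogeneous_of_vecWeight {F : VecPoly V} {k : V → ℕ}
    (hF : F.IsWeightedHomogeneous vecWeight k) : F.IsHomogeneous (∑ v, k v) := by
  intro m hm
  rw [← hF hm, Finsupp.weight_apply, Finsupp.weight_apply, Finsupp.sum_fintype _ _ (by simp),
    Finsupp.sum_fintype _ _ (by simp)]
  simp only [Finset.sum_apply, Pi.smul_apply, vecWeight, Pi.one_apply, smul_eq_mul, mul_one,
    Pi.single_apply, mul_ite, mul_zero]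
  rw [Finset.sum_comm]
  simp

theorem invPoly_le_span_graphMonomial (k : V → ℕ) :
    invPoly k ≤ Submodule.span ℂ {G | ∃ s, graphDegree s = k ∧ graphMonomial s = G} := by
  intro F hF
  obtain ⟨hr, hl⟩ := raise_eq_zero_and_lower_eq_zero hF.2
  exact mem_span_graphMonomial (mem_adjoin_bracket (isHomogeneous_of_vecWeight hF.1) hr hl) hF.1

theorem sum_graphDegree (s : Multiset (V × V)) : ∑ v, graphDegree s v = 2 * s.card := by
  induction s using Multiset.induction_on with
  | empty => simp
  | cons p s ih =>
    simp only [graphDegree_cons, Pi.add_apply, Finset.sum_add_distrib, ih, Multiset.card_cons,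
      Finset.sum_pi_single', Finset.mem_univ, if_true]
    ring

/-- By the handshake lemma no multigraph has odd total degree, so for an odd sum the spanning set of
bracket monomials is empty. -/
theorem even_of_mem_invPoly {k : V → ℕ} {F : VecPoly V} (hF : F ∈ invPoly k) (h0 : F ≠ 0) :
    Even (∑ v, k v) := by
  by_contra hodd
  have := invPoly_le_span_graphMonomial k hF
  rw [show {G | ∃ s, graphDegree s = k ∧ graphMonomial s = G} = ∅ from
    Set.eq_empty_of_forall_notMem fun G ⟨s, hs, _⟩ => hodd (by
      rw [← hs, sum_graphDegree]; exact even_two_mul _), Submodule.span_empty] at this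
  exact h0 this

omit [Fintype V] in
/-- A regular bipartite multigraph gives a product of invariants of lowest degree. -/
theorem rename_bipartite_mem_pow {A : Type*} [DecidableEq A] [Fintype A] (f : A ⊕ A → V)
    (w : V → ℕ) (hw : ∀ v, (Finset.univ.filter fun a => f a = v).card = w v) (d : ℕ)
    (t : Multiset (A × A)) (h1 : ∀ a, (t.map Prod.fst).count a = d)
    (h2 : ∀ a, (t.map Prod.snd).count a = d) :
    rename (Prod.map f id) (graphMonomial (bipartiteGraph t)) ∈ invPoly w ^ d := by
  induction d generalizing t with
  | zero =>
    obtain rfl : t = 0 := by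
      refine Multiset.eq_zero_of_forall_notMem fun p hp => ?_
      exact Multiset.count_eq_zero.1 (h1 p.1) (Multiset.mem_map_of_mem _ hp)
    simpa [bipartiteGraph] using ⟨1, C_1⟩
  | succ d ih =>
    obtain ⟨σ, t', rfl⟩ := exists_perfect_matching t h1 h2
    have c1 : ∀ a, ((Finset.univ.val.map fun a => (a, σ a)).map Prod.fst).count a = 1 := by
      intro a
      rw [Multiset.map_map]
      exact (congrArg (Multiset.count a) (Multiset.map_id' _)).trans
        (Multiset.count_eq_one_of_mem Finset.univ.nodup (Finset.mem_univ a))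
    have c2 : ∀ a, ((Finset.univ.val.map fun a => (a, σ a)).map Prod.snd).count a = 1 := by
      intro a
      rw [Multiset.map_map]
      refine Multiset.count_eq_one_of_mem (Finset.univ.nodup.map σ.injective) ?_
      exact Multiset.mem_map.2 ⟨σ.symm a, Finset.mem_univ _, by simp⟩
    simp only [Multiset.map_add, Multiset.count_add, c1, c2] at h1 h2
    rw [bipartiteGraph, Multiset.map_add, graphMonomial_add, map_mul, pow_succ']
    refine Submodule.mul_mem_mul ?_
      (ih t' (fun a => by have := h1 a; omega) (fun a => by have := h2 a; omega))
    rw [rename_graphMonomial]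
    -- A perfect matching meets every copy once, so after the copies are merged the degree at `v` is
    -- the size `w v` of its fibre.
    have hm := graphMonomial_mem_invPoly (((Finset.univ.val.map fun a => (a, σ a)).map
      fun p : A × A => ((Sum.inl p.1 : A ⊕ A), (Sum.inr p.2 : A ⊕ A))).map (Prod.map f f))
    convert hm using 2
    funext v
    rw [← hw v, graphDegree]
    simp only [Multiset.map_map, Function.comp_def, Prod.map_fst, Prod.map_snd, Multiset.count_map,
      ← Finset.filter_val, Finset.card_val, Finset.card_filter, Fintype.sum_sum_type, eq_comm]
    rw [Equiv.sum_comp σ fun a => if v = f (Sum.inr a) then 1 else 0]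

/-- Kempe's theorem: invariants of multidegree `d • w` are generated by those of multidegree `w`. -/
theorem invPoly_smul_le_pow (w : V → ℕ) (hw : Even (∑ v, w v)) (d : ℕ) :
    invPoly (d • w) ≤ invPoly w ^ d := by
  obtain ⟨M, hM⟩ := hw
  -- Evenness of `∑ w` lets the copies of the vertices be divided into two colour classes of equal
  -- size; any division works.
  have e : Fin M ⊕ Fin M ≃ Σ v, Fin (w v) := Fintype.equivOfCardEq (by simp [hM])
  let f : Fin M ⊕ Fin M → V := fun a => (e a).1
  have hf : ∀ v, (Finset.univ.filter fun a => f a = v).card = w v := by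
    intro v
    have : (Finset.univ.filter fun a => f a = v) =
        (Finset.univ.map (Function.Embedding.sigmaMk v)).map e.symm.toEmbedding := by
      ext a
      simp only [Finset.mem_filter, Finset.mem_univ, true_and, Finset.mem_map,
        Equiv.coe_toEmbedding, Function.Embedding.sigmaMk_apply, exists_exists_eq_and,
        Equiv.symm_apply_eq, f]
      constructor
      · rintro rfl
        exact ⟨(e a).2, rfl⟩
      · rintro ⟨i, hi⟩
        rw [← hi]
    rw [this, Finset.card_map, Finset.card_map, Finset.card_univ, Fintype.card_fin]
  refine (invPoly_le_span_graphMonomial _).trans (Submodule.span_le.2 ?_)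
  rintro _ ⟨s, hs, rfl⟩
  obtain ⟨t, rfl, ht⟩ := exists_graph_lift f s (fun _ => d) fun v => by
    rw [hs, Finset.sum_const, hf, smul_eq_mul, Pi.smul_apply, smul_eq_mul, mul_comm]
  rw [← rename_graphMonomial, SetLike.mem_coe]
  change graphMonomial t ∈ (invPoly w ^ d).comap
    (rename (Prod.map f id) : VecPoly (Fin M ⊕ Fin M) →ₐ[ℂ] VecPoly V).toLinearMap
  refine Submodule.span_le.2 ?_ (graphMonomial_mem_span_bipartite t (by simp [ht]))
  rintro _ ⟨u, hu, rfl⟩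
  rw [ht] at hu
  exact rename_bipartite_mem_pow f w hf d u
    (fun a => by rw [← graphDegree_bipartiteGraph_inl, hu])
    (fun a => by rw [← graphDegree_bipartiteGraph_inr, hu])

end Invariant

/-! ### The dictionary between tensors and multihomogeneous polynomials. -/

section Tensor

variable {n : ℕ} {N : Fin n → ℕ}

/-- The exponents of the monomial `∏ x_i ^ A_i y_i ^ (N_i - A_i)`. -/
def formExponent (A : (i : Fin n) → Fin (N i + 1)) : Fin n × Fin 2 →₀ ℕ :=
  Finsupp.equivFunOnFinite.symm fun p => if p.2 = 0 then (A p.1 : ℕ) else N p.1 - A p.1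

@[simp] theorem formExponent_apply (A : (i : Fin n) → Fin (N i + 1)) (p : Fin n × Fin 2) :
    formExponent A p = if p.2 = 0 then (A p.1 : ℕ) else N p.1 - A p.1 := rfl

theorem formExponent_injective :
    Function.Injective (formExponent : ((i : Fin n) → Fin (N i + 1)) → _) := by
  intro A B h
  funext i
  exact Fin.ext (by simpa using DFunLike.congr_fun h (i, 0))

theorem weight_vecWeight (m : Fin n × Fin 2 →₀ ℕ) (i : Fin n) :
    Finsupp.weight vecWeight m i = m (i, 0) + m (i, 1) := by
  rw [Finsupp.weight_apply, Finsupp.sum_fintype _ _ (by simp), Fintype.sum_prod_type]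
  simp [vecWeight, Pi.single_apply, Finset.sum_add_distrib]

theorem prod_sqrt_choose_ne_zero (A : (i : Fin n) → Fin (N i + 1)) :
    ∏ i, (√((N i).choose (A i) : ℝ) : ℂ) ≠ 0 :=
  Finset.prod_ne_zero_iff.2 fun i _ => sqrt_choose_ne_zero (Nat.lt_succ_iff.1 (A i).2)

/-- A tensor as a multihomogeneous polynomial. -/
def toPoly (N : Fin n → ℕ) : TensorSpace N →ₗ[ℂ] VecPoly (Fin n) where
  toFun o := ∑ A, monomial (formExponent A) (o A * ∏ i, (√((N i).choose (A i) : ℝ) : ℂ))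
  map_add' o o' := by simp [add_mul, Finset.sum_add_distrib]
  map_smul' c o := by simp [mul_assoc, Finset.smul_sum, smul_monomial]

theorem toPoly_apply (o : TensorSpace N) :
    toPoly N o = ∑ A, monomial (formExponent A) (o A * ∏ i, (√((N i).choose (A i) : ℝ) : ℂ)) := rfl

theorem coeff_toPoly (o : TensorSpace N) (A : (i : Fin n) → Fin (N i + 1)) :
    coeff (formExponent A) (toPoly N o) = o A * ∏ i, (√((N i).choose (A i) : ℝ) : ℂ) := by
  rw [toPoly_apply, coeff_sum, Finset.sum_eq_single_of_mem A (Finset.mem_univ _)]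
  · rw [coeff_monomial, if_pos rfl]
  · intro B _ hB
    rw [coeff_monomial, if_neg fun h => hB (formExponent_injective h)]

theorem toPoly_injective : Function.Injective (toPoly N) := by
  intro o o' h
  ext A
  have := coeff_toPoly o A
  rw [h, coeff_toPoly] at this
  exact (mul_right_cancel₀ (prod_sqrt_choose_ne_zero A) this).symm

theorem isWeightedHomogeneous_toPoly (o : TensorSpace N) :
    (toPoly N o).IsWeightedHomogeneous vecWeight N := by
  refine IsWeightedHomogeneous.sum _ _ _ fun A _ => isWeightedHomogeneous_monomial _ _ _ ?_
  funext i
  have := (A i).2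
  rw [weight_vecWeight]
  simp
  omega

theorem exists_toPoly_eq {F : VecPoly (Fin n)} (hF : F.IsWeightedHomogeneous vecWeight N) :
    ∃ o, toPoly N o = F := by
  refine ⟨WithLp.toLp 2 fun A =>
    coeff (formExponent A) F / ∏ i, (√((N i).choose (A i) : ℝ) : ℂ), ?_⟩
  ext m
  by_cases hm : Finsupp.weight vecWeight m = N
  · have h : ∀ i, m (i, 0) + m (i, 1) = N i := fun i => by rw [← weight_vecWeight, hm]
    obtain ⟨A, rfl⟩ : ∃ A : (i : Fin n) → Fin (N i + 1), formExponent A = m := by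
      refine ⟨fun i => ⟨m (i, 0), by have := h i; omega⟩, ?_⟩
      ext ⟨i, b⟩
      have := h i
      fin_cases b
      · simp
      · simp; omega
    rw [coeff_toPoly]
    exact div_mul_cancel₀ _ (prod_sqrt_choose_ne_zero A)
  · rw [(isWeightedHomogeneous_toPoly _).coeff_eq_zero m hm, hF.coeff_eq_zero m hm]

theorem eval_toPoly (o : TensorSpace N) (z : Fin n × Fin 2 → ℂ) :
    eval z (toPoly N o) = ∑ A, o A * ∏ i, basisForm (N i) (z (i, 0)) (z (i, 1)) (A i) := by
  rw [toPoly_apply, map_sum]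
  refine Finset.sum_congr rfl fun A _ => ?_
  rw [eval_monomial, Finsupp.prod_fintype _ _ (by simp), Fintype.prod_prod_type, mul_assoc,
    ← Finset.prod_mul_distrib]
  congr 1
  refine Finset.prod_congr rfl fun i _ => ?_
  simp [basisForm, Fin.prod_univ_two, mul_assoc]

theorem sum_prod_eq_prod_sum {κ : Fin n → Type*} [∀ i, Fintype (κ i)]
    (f : (i : Fin n) → κ i → ℂ) : ∑ A : (i : Fin n) → κ i, ∏ i, f i (A i) = ∏ i, ∑ a, f i a := by
  classical
  rw [Finset.prod_univ_sum, Fintype.piFinset_univ]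

theorem toPoly_action (g : Matrix (Fin 2) (Fin 2) ℂ) (o : TensorSpace N) :
    toPoly N (WithLp.toLp 2 fun A => ∑ B, (∏ i, spinMatrix (N i) g (A i) (B i)) * o B) =
      subst g (toPoly N o) := by
  refine MvPolynomial.funext fun z => ?_
  rw [eval_subst, eval_toPoly, eval_toPoly]
  simp only [← sum_basisForm_spinMatrix, ← sum_prod_eq_prod_sum, Finset.mul_sum, Finset.sum_mul]
  rw [Finset.sum_comm]
  refine Finset.sum_congr rfl fun B _ => Finset.sum_congr rfl fun A _ => ?_
  rw [Finset.prod_mul_distrib]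
  ring

theorem toPoly_mem_invPoly {o : TensorSpace N} : toPoly N o ∈ invPoly N ↔ o ∈ Inv N := by
  rw [mem_invPoly]
  simp only [← toPoly_action, toPoly_injective.eq_iff]
  refine ⟨fun h g hg A => ?_, fun h => ⟨isWeightedHomogeneous_toPoly o, fun g hg => ?_⟩⟩
  · exact congrArg (fun o : TensorSpace N => o A) (h.2 g hg)
  · ext A
    exact h g hg A

theorem exists_mem_inv_toPoly_eq {F : VecPoly (Fin n)} (hF : F ∈ invPoly N) :
    ∃ o ∈ Inv N, toPoly N o = F := by
  obtain ⟨o, rfl⟩ := exists_toPoly_eq hF.1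
  exact ⟨o, toPoly_mem_invPoly.1 hF, rfl⟩

/-- The complex conjugate of a tensor. -/
def conjTensor (o : TensorSpace N) : TensorSpace N := WithLp.toLp 2 fun A => star (o A)

@[simp] theorem conjTensor_apply (o : TensorSpace N) (A : (i : Fin n) → Fin (N i + 1)) :
    conjTensor o A = star (o A) := rfl

theorem spinMatrix_map_star (K : ℕ) (g : Matrix (Fin 2) (Fin 2) ℂ) (a b : Fin (K + 1)) :
    spinMatrix K (g.map star) a b = star (spinMatrix K g a b) := by
  have h := spinMatrix_conjTranspose K g.transpose
  rw [spinMatrix_transpose] at h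
  exact congrFun (congrFun h a) b

theorem map_star_mem_specialUnitaryGroup {g : Matrix (Fin 2) (Fin 2) ℂ}
    (hg : g ∈ Matrix.specialUnitaryGroup (Fin 2) ℂ) :
    g.map star ∈ Matrix.specialUnitaryGroup (Fin 2) ℂ := by
  obtain ⟨h1, h2⟩ := Matrix.mem_specialUnitaryGroup_iff.1 hg
  rw [Matrix.mem_unitaryGroup_iff] at h1
  rw [Matrix.mem_specialUnitaryGroup_iff, Matrix.mem_unitaryGroup_iff]
  constructor
  · have h3 : star (g.map star) = g.transpose := by
      ext i j
      simp [Matrix.star_apply]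
    have h4 : g.map star = (star g).transpose := rfl
    rw [h3, h4, ← Matrix.transpose_mul, h1, Matrix.transpose_one]
  · have := congrArg star h2
    rwa [← Matrix.det_conjTranspose, star_one, ← Matrix.det_transpose] at this

/-- SU(2) is stable under entrywise conjugation, and the spin matrices are polynomials in the
entries with real coefficients. Conjugates serve as test vectors that undo the antilinearity of the
inner product. -/
theorem conjTensor_mem_inv {o : TensorSpace N} (ho : o ∈ Inv N) : conjTensor o ∈ Inv N := by
  intro g hg A
  have := congrArg star (ho _ (map_star_mem_specialUnitaryGroup hg) A)
  rw [star_sum] at this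
  rw [conjTensor_apply, ← this]
  refine Finset.sum_congr rfl fun B _ => ?_
  simp only [spinMatrix_map_star, conjTensor_apply, star_mul', star_prod, star_star]

end Tensor

/-! ### Clebsch–Gordan coefficients at extremal spins. -/

theorem eq_of_sum_basisForm_basisForm {K L : ℕ} {Φ Ψ : Fin (K + 1) → Fin (L + 1) → ℂ}
    (h : ∀ x x', ∑ p, ∑ q, basisForm K x 1 p * basisForm L x' 1 q * Φ p q =
      ∑ p, ∑ q, basisForm K x 1 p * basisForm L x' 1 q * Ψ p q) (p : Fin (K + 1))
    (q : Fin (L + 1)) : Φ p q = Ψ p q := by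
  rw [← sub_eq_zero]
  have h1 := fun x' => congrFun (eq_zero_of_sum_basisForm (v := fun p =>
    ∑ q, basisForm L x' 1 q * (Φ p q - Ψ p q)) fun x => by
      simpa only [Finset.mul_sum, mul_sub, Finset.sum_sub_distrib, sub_eq_zero, mul_assoc]
        using h x x') p
  exact congrFun (eq_zero_of_sum_basisForm (v := fun q => Φ p q - Ψ p q) h1) q

/-- For `N = K + L` the adjoint of the Clebsch–Gordan map is multiplication. -/
theorem sum_basisForm_mul_cgRaw_add (K L : ℕ) (s t : ℂ) (p : Fin (K + 1)) (q : Fin (L + 1)) :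
    ∑ m, basisForm (K + L) s t m * cgRaw (K + L) K L (p, q) m =
      basisForm K s t p * basisForm L s t q := by
  refine eq_of_sum_basisForm_basisForm
    (Φ := fun p q => ∑ m, basisForm (K + L) s t m * cgRaw (K + L) K L (p, q) m)
    (Ψ := fun p q => basisForm K s t p * basisForm L s t q) (fun x x' => ?_) p q
  have h := sum_cgRaw (K + L) K L le_rfl (by omega) (by omega) ⟨K + L, by ring⟩ x 1 x' 1 s t
  rw [show (K + L - (K + L)) / 2 = 0 by omega, show (K + L + K - L) / 2 = K by omega,
    show (K + L + L - K) / 2 = L by omega, pow_zero, one_mul, ← sum_basisForm_basisForm,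
    ← sum_basisForm_basisForm, Finset.sum_mul_sum] at h
  refine Eq.trans ?_ (h.trans ?_)
  · refine Finset.sum_congr rfl fun p _ => Finset.sum_congr rfl fun q _ => ?_
    rw [Finset.mul_sum]
    exact Finset.sum_congr rfl fun m _ => by ring
  · exact Finset.sum_congr rfl fun p _ => Finset.sum_congr rfl fun q _ => by ring

/-- For `K = N + L` the generating function is `(x y' - y x') ^ L (s x + t y) ^ N`, again a product
of two pairings. The first pairs `(x', y')` with the rotated vector `(-y, x)`. -/
theorem sum_basisForm_mul_cgRaw_left (N L : ℕ) (x y : ℂ) (q : Fin (L + 1)) (m : Fin (N + 1)) :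
    ∑ p, basisForm (N + L) x y p * cgRaw N (N + L) L (p, q) m =
      basisForm L (-y) x q * basisForm N x y m := by
  refine eq_of_sum_basisForm_basisForm
    (Φ := fun q m => ∑ p, basisForm (N + L) x y p * cgRaw N (N + L) L (p, q) m)
    (Ψ := fun q m => basisForm L (-y) x q * basisForm N x y m) (fun x' s => ?_) q m
  have h := sum_cgRaw N (N + L) L (by omega) le_rfl (by omega) ⟨N + L, by ring⟩ x y x' 1 s 1
  rw [show (N + L + L - N) / 2 = L by omega, show (N + (N + L) - L) / 2 = N by omega,
    show (N + L - (N + L)) / 2 = 0 by omega, pow_zero, mul_one,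
    show x * 1 - y * x' = x' * -y + 1 * x by ring, ← sum_basisForm_basisForm,
    ← sum_basisForm_basisForm, Finset.sum_mul_sum, Finset.sum_comm] at h
  refine Eq.trans ?_ (h.trans ?_)
  · refine Finset.sum_congr rfl fun q _ => ?_
    simp only [Finset.mul_sum]
    rw [Finset.sum_comm]
    exact Finset.sum_congr rfl fun p _ => Finset.sum_congr rfl fun m _ => by ring
  · exact Finset.sum_congr rfl fun q _ => Finset.sum_congr rfl fun m _ => by ring

theorem sum_basisForm_mul_cgRaw_right (N K : ℕ) (x y : ℂ) (p : Fin (K + 1)) (m : Fin (N + 1)) :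
    ∑ q, basisForm (N + K) x y q * cgRaw N K (N + K) (p, q) m =
      basisForm K y (-x) p * basisForm N x y m := by
  refine eq_of_sum_basisForm_basisForm
    (Φ := fun p m => ∑ q, basisForm (N + K) x y q * cgRaw N K (N + K) (p, q) m)
    (Ψ := fun p m => basisForm K y (-x) p * basisForm N x y m) (fun x' s => ?_) p m
  have h := sum_cgRaw N K (N + K) (by omega) (by omega) le_rfl ⟨N + K, by ring⟩ x' 1 x y s 1
  rw [show (K + (N + K) - N) / 2 = K by omega, show (N + K - (N + K)) / 2 = 0 by omega,
    show (N + (N + K) - K) / 2 = N by omega, pow_zero, mul_one,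
    show x' * y - 1 * x = x' * y + 1 * -x by ring, ← sum_basisForm_basisForm,
    ← sum_basisForm_basisForm, Finset.sum_mul_sum] at h
  refine Eq.trans ?_ (h.trans ?_)
  · refine Finset.sum_congr rfl fun p _ => ?_
    simp only [Finset.mul_sum]
    rw [Finset.sum_comm]
    exact Finset.sum_congr rfl fun q _ => Finset.sum_congr rfl fun m _ => by ring
  · exact Finset.sum_congr rfl fun p _ => Finset.sum_congr rfl fun m _ => by ring

/-! ### Testing the vanishing of `ι(o)` against invariants. -/

section Contraction

variable {n : ℕ} {k jp jm : Fin n → ℕ}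

/-- The array of the tensor product of the unnormalised Clebsch–Gordan maps. -/
def cgProd (k jp jm : Fin n → ℕ) (Bp : (i : Fin n) → Fin (jp i + 1))
    (Bm : (i : Fin n) → Fin (jm i + 1)) (A : (i : Fin n) → Fin (k i + 1)) : ℂ :=
  ∏ i, cgRaw (k i) (jp i) (jm i) (Bp i, Bm i) (A i)

theorem star_cgRaw (N K L : ℕ) (pq : Fin (K + 1) × Fin (L + 1)) (m : Fin (N + 1)) :
    star (cgRaw N K L pq m) = cgRaw N K L pq m := by
  have hs : ∀ r : ℝ, star (r : ℂ) = r := Complex.conj_ofReal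
  simp only [cgRaw, star_div₀, star_mul', star_sum, hs, apply_ite star, star_pow, star_neg,
    star_one, star_natCast, star_zero]

theorem star_cgProd (Bp : (i : Fin n) → Fin (jp i + 1))
    (Bm : (i : Fin n) → Fin (jm i + 1)) (A : (i : Fin n) → Fin (k i + 1)) :
    star (cgProd k jp jm Bp Bm A) = cgProd k jp jm Bp Bm A := by
  simp only [cgProd, star_prod, star_cgRaw]

/-- The projection is self-adjoint and fixes `G`, so it drops out. -/
theorem inner_invProj_single {N : Fin n → ℕ} {G : TensorSpace N} (hG : G ∈ Inv N)
    (B : (i : Fin n) → Fin (N i + 1)) :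
    inner ℂ (⟨G, hG⟩ : Inv N) (invProj N (EuclideanSpace.single B 1)) = star (G B) := by
  rw [invProj, ContinuousLinearMap.coe_coe,
    Submodule.inner_orthogonalProjectionOnto_eq_of_mem_left]
  simp [EuclideanSpace.inner_single_right]

/-- The matrix elements of the vanishing vector `ι(o)`. -/
theorem sum_eq_zero_of_eprl_eq_zero (h1 : ∀ i, k i ≤ jp i + jm i) (h2 : ∀ i, jm i ≤ k i + jp i)
    {o : Inv k} (ho : eprl k jp jm o = 0) {G : TensorSpace jp} {H : TensorSpace jm}
    (hG : G ∈ Inv jp) (hH : H ∈ Inv jm) :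
    ∑ Bp, ∑ Bm, (∑ A, (o : TensorSpace k) A * cgProd k jp jm Bp Bm A) *
      (star (G Bp) * star (H Bm)) = 0 := by
  -- The normalisations of the Clebsch–Gordan maps form one nonzero scalar, which can be divided
  -- out.
  set c : ℂ := ∏ i, ((√(∑ pq, ‖cgRaw (k i) (jp i) (jm i) pq 0‖ ^ 2) : ℝ) : ℂ)⁻¹ with hc
  have hc0 : c ≠ 0 := Finset.prod_ne_zero_iff.2 fun i _ => inv_ne_zero
    (Complex.ofReal_ne_zero.2 (Real.sqrt_pos.2 (cgRaw_norm_pos (h1 i) (h2 i))).ne')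
  have h := congrArg (LinearMap.mul' ℂ ℂ ∘ₗ TensorProduct.map
    (innerSL ℂ (⟨G, hG⟩ : Inv jp)).toLinearMap (innerSL ℂ (⟨H, hH⟩ : Inv jm)).toLinearMap) ho
  rw [map_zero] at h
  refine (mul_eq_zero.1 (Eq.trans ?_ h)).resolve_left hc0
  simp only [eprl, LinearMap.coe_mk, AddHom.coe_mk, map_sum, map_smul, LinearMap.comp_apply,
    TensorProduct.map_tmul, LinearMap.mul'_apply, ContinuousLinearMap.coe_coe, innerSL_apply_apply,
    inner_invProj_single, smul_eq_mul, cg, Matrix.smul_apply, Finset.prod_mul_distrib, ← hc,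
    cgProd, Finset.mul_sum, Finset.sum_mul]
  refine Finset.sum_congr rfl fun _ _ => Finset.sum_congr rfl fun _ _ =>
    Finset.sum_congr rfl fun _ _ => ?_
  ring

/-- The adjoint of the Clebsch–Gordan maps, applied to a product. -/
def cgMul (k : Fin n → ℕ) (G : TensorSpace jp) (H : TensorSpace jm) : TensorSpace k :=
  WithLp.toLp 2 fun A => ∑ Bp, ∑ Bm, G Bp * H Bm * cgProd k jp jm Bp Bm A

theorem toPoly_cgMul (hk : k = jp + jm) (G : TensorSpace jp) (H : TensorSpace jm) :
    toPoly k (cgMul k G H) = toPoly jp G * toPoly jm H := by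
  subst hk
  refine MvPolynomial.funext fun z => ?_
  rw [map_mul, eval_toPoly, eval_toPoly, eval_toPoly, Finset.sum_mul_sum]
  simp only [cgMul, Finset.sum_mul]
  rw [Finset.sum_comm]
  refine Finset.sum_congr rfl fun Bp _ => ?_
  rw [Finset.sum_comm]
  refine Finset.sum_congr rfl fun Bm _ => ?_
  have : ∑ A : (i : Fin n) → Fin ((jp + jm) i + 1), cgProd (jp + jm) jp jm Bp Bm A *
      ∏ i, basisForm ((jp + jm) i) (z (i, 0)) (z (i, 1)) (A i) =
      (∏ i, basisForm (jp i) (z (i, 0)) (z (i, 1)) (Bp i)) *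
      ∏ i, basisForm (jm i) (z (i, 0)) (z (i, 1)) (Bm i) := by
    simp only [cgProd, ← Finset.prod_mul_distrib]
    rw [sum_prod_eq_prod_sum fun i a => cgRaw ((jp + jm) i) (jp i) (jm i) (Bp i, Bm i) a *
      basisForm ((jp + jm) i) (z (i, 0)) (z (i, 1)) a]
    refine Finset.prod_congr rfl fun i _ => ?_
    rw [← sum_basisForm_mul_cgRaw_add]
    exact Finset.sum_congr rfl fun _ _ => mul_comm _ _
  simp only [mul_assoc, ← Finset.mul_sum, this]
  ring

/-- Contraction of the second factor. -/
def contractRight (jp : Fin n → ℕ) (o : TensorSpace k) (H : TensorSpace jm) : TensorSpace jp :=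
  WithLp.toLp 2 fun Bp => ∑ Bm, ∑ A, o A * H Bm * cgProd k jp jm Bp Bm A

/-- The contraction evaluates `H` at the rotated vectors `(-y, x)`. That quarter turn lies in SU(2),
so the invariance of `H` removes it. -/
theorem toPoly_contractRight (hjp : jp = k + jm) (o : TensorSpace k) {H : TensorSpace jm}
    (hH : H ∈ Inv jm) : toPoly jp (contractRight jp o H) = toPoly jm H * toPoly k o := by
  subst hjp
  have hg : !![(0 : ℂ), 1; -1, 0] ∈ Matrix.specialUnitaryGroup (Fin 2) ℂ := by
    simpa using rotation_mem (-1) 1 (Real.pi / 2)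
  rw [← (toPoly_mem_invPoly.2 hH).2 _ hg]
  refine MvPolynomial.funext fun z => ?_
  rw [map_mul, eval_subst, eval_toPoly, eval_toPoly, eval_toPoly, Finset.sum_mul_sum]
  simp only [contractRight, Finset.sum_mul]
  rw [Finset.sum_comm]
  refine Finset.sum_congr rfl fun Bm _ => ?_
  rw [Finset.sum_comm]
  refine Finset.sum_congr rfl fun A _ => ?_
  have : ∑ Bp : (i : Fin n) → Fin ((k + jm) i + 1), cgProd k (k + jm) jm Bp Bm A *
      ∏ i, basisForm ((k + jm) i) (z (i, 0)) (z (i, 1)) (Bp i) =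
      (∏ i, basisForm (jm i) (-z (i, 1)) (z (i, 0)) (Bm i)) *
      ∏ i, basisForm (k i) (z (i, 0)) (z (i, 1)) (A i) := by
    simp only [cgProd, ← Finset.prod_mul_distrib]
    rw [sum_prod_eq_prod_sum fun i b => cgRaw (k i) ((k + jm) i) (jm i) (b, Bm i) (A i) *
      basisForm ((k + jm) i) (z (i, 0)) (z (i, 1)) b]
    refine Finset.prod_congr rfl fun i _ => ?_
    rw [← sum_basisForm_mul_cgRaw_left]
    exact Finset.sum_congr rfl fun _ _ => mul_comm _ _
  simp only [mul_assoc, ← Finset.mul_sum, this]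
  simp
  ring

/-- Contraction of the first factor. -/
def contractLeft (jm : Fin n → ℕ) (o : TensorSpace k) (G : TensorSpace jp) : TensorSpace jm :=
  WithLp.toLp 2 fun Bm => ∑ Bp, ∑ A, o A * G Bp * cgProd k jp jm Bp Bm A

theorem toPoly_contractLeft (hjm : jm = k + jp) (o : TensorSpace k) {G : TensorSpace jp}
    (hG : G ∈ Inv jp) : toPoly jm (contractLeft jm o G) = toPoly jp G * toPoly k o := by
  subst hjm
  have hg : !![(0 : ℂ), -1; 1, 0] ∈ Matrix.specialUnitaryGroup (Fin 2) ℂ := by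
    simpa using rotation_mem 1 (-1) (Real.pi / 2)
  rw [← (toPoly_mem_invPoly.2 hG).2 _ hg]
  refine MvPolynomial.funext fun z => ?_
  rw [map_mul, eval_subst, eval_toPoly, eval_toPoly, eval_toPoly, Finset.sum_mul_sum]
  simp only [contractLeft, Finset.sum_mul]
  rw [Finset.sum_comm]
  refine Finset.sum_congr rfl fun Bp _ => ?_
  rw [Finset.sum_comm]
  refine Finset.sum_congr rfl fun A _ => ?_
  have : ∑ Bm : (i : Fin n) → Fin ((k + jp) i + 1), cgProd k jp (k + jp) Bp Bm A *
      ∏ i, basisForm ((k + jp) i) (z (i, 0)) (z (i, 1)) (Bm i) =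
      (∏ i, basisForm (jp i) (z (i, 1)) (-z (i, 0)) (Bp i)) *
      ∏ i, basisForm (k i) (z (i, 0)) (z (i, 1)) (A i) := by
    simp only [cgProd, ← Finset.prod_mul_distrib]
    rw [sum_prod_eq_prod_sum fun i b => cgRaw (k i) (jp i) ((k + jp) i) (Bp i, b) (A i) *
      basisForm ((k + jp) i) (z (i, 0)) (z (i, 1)) b]
    refine Finset.prod_congr rfl fun i _ => ?_
    rw [← sum_basisForm_mul_cgRaw_right]
    exact Finset.sum_congr rfl fun _ _ => mul_comm _ _
  simp only [mul_assoc, ← Finset.mul_sum, this]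
  simp
  ring

theorem eq_zero_of_sum_mul_star {N : Fin n → ℕ} {T : TensorSpace N}
    (h : ∑ B, T B * star (T B) = 0) : T = 0 := by
  rw [← inner_self_eq_zero (𝕜 := ℂ), PiLp.inner_apply, ← h]
  rfl

/-- Pairing `ι(o)` with `G ⊗ H` gives, up to a nonzero scalar, the inner product of `o` with the
tensor of the polynomial `G H`. If such products span, `o` is orthogonal to itself. -/
theorem eq_zero_of_eprl_eq_zero_of_add (hk : k = jp + jm) {o : Inv k}
    (ho : eprl k jp jm o = 0) (hle : invPoly k ≤ invPoly jp * invPoly jm) : o = 0 := by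
  have key : invPoly jp * invPoly jm ≤
      (ℂ ∙ (o : TensorSpace k))ᗮ.map (toPoly k) := by
    refine Submodule.mul_le.2 fun F hF F' hF' => ?_
    obtain ⟨G, hG, rfl⟩ := exists_mem_inv_toPoly_eq hF
    obtain ⟨H, hH, rfl⟩ := exists_mem_inv_toPoly_eq hF'
    refine ⟨cgMul k G H, ?_, toPoly_cgMul hk G H⟩
    have h := sum_eq_zero_of_eprl_eq_zero (by simp [hk]) (fun i => by simp [hk]; omega) ho hG hH
    rw [SetLike.mem_coe, Submodule.mem_orthogonal_singleton_iff_inner_left, PiLp.inner_apply, ← h]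
    have e : ∀ A, inner ℂ (cgMul k G H A) ((o : TensorSpace k) A) =
        (o : TensorSpace k) A * star (cgMul k G H A) := fun _ => rfl
    refine (Finset.sum_congr rfl fun A _ => e A).trans ?_
    simp only [cgMul, star_sum, star_mul', star_cgProd, Finset.mul_sum, Finset.sum_mul]
    rw [Finset.sum_comm]
    refine Finset.sum_congr rfl fun Bp _ => ?_
    rw [Finset.sum_comm]
    exact Finset.sum_congr rfl fun Bm _ => Finset.sum_congr rfl fun A _ => by ring
  obtain ⟨Q, hQ, hQo⟩ := key (hle (toPoly_mem_invPoly.2 o.2))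
  rw [toPoly_injective hQo, SetLike.mem_coe,
    Submodule.mem_orthogonal_singleton_iff_inner_left, inner_self_eq_zero] at hQ
  exact Subtype.ext hQ

/-- The contraction `T` of `o` with `H` is the polynomial `H o`, hence invariant. Testing `ι(o)`
against `T` and the conjugate of `H` gives `‖T‖² = 0`, so `H o = 0` in an integral domain. -/
theorem eq_zero_of_eprl_eq_zero_of_left (hjp : jp = k + jm) {o : Inv k}
    (ho : eprl k jp jm o = 0) {F : VecPoly (Fin n)} (hF : F ∈ invPoly jm) (h0 : F ≠ 0) :
    o = 0 := by
  obtain ⟨H, hH, rfl⟩ := exists_mem_inv_toPoly_eq hF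
  have hT := toPoly_contractRight hjp (o : TensorSpace k) hH
  have hTi : contractRight jp (o : TensorSpace k) H ∈ Inv jp := by
    rw [← toPoly_mem_invPoly, hT, hjp, add_comm]
    exact mul_mem_invPoly hF (toPoly_mem_invPoly.2 o.2)
  have h := sum_eq_zero_of_eprl_eq_zero (fun i => by simp [hjp]; omega)
    (fun i => by simp [hjp]; omega) ho hTi (conjTensor_mem_inv hH)
  have hT0 : contractRight jp (o : TensorSpace k) H = 0 := by
    refine eq_zero_of_sum_mul_star (Eq.trans (Finset.sum_congr rfl fun Bp _ => ?_) h)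
    simp only [conjTensor_apply, star_star]
    rw [contractRight, Finset.sum_mul]
    refine Finset.sum_congr rfl fun Bm _ => ?_
    rw [Finset.sum_mul, Finset.sum_mul]
    exact Finset.sum_congr rfl fun A _ => by ring
  rw [hT0, map_zero] at hT
  have := (mul_eq_zero.1 hT.symm).resolve_left h0
  exact Subtype.ext (toPoly_injective (this.trans (map_zero _).symm))

theorem eq_zero_of_eprl_eq_zero_of_right (hjm : jm = k + jp) {o : Inv k}
    (ho : eprl k jp jm o = 0) {F : VecPoly (Fin n)} (hF : F ∈ invPoly jp) (h0 : F ≠ 0) :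
    o = 0 := by
  obtain ⟨G, hG, rfl⟩ := exists_mem_inv_toPoly_eq hF
  have hT := toPoly_contractLeft hjm (o : TensorSpace k) hG
  have hTi : contractLeft jm (o : TensorSpace k) G ∈ Inv jm := by
    rw [← toPoly_mem_invPoly, hT, hjm, add_comm]
    exact mul_mem_invPoly hF (toPoly_mem_invPoly.2 o.2)
  have h := sum_eq_zero_of_eprl_eq_zero (fun i => by simp [hjm]; omega)
    (fun i => by simp [hjm]) ho (conjTensor_mem_inv hG) hTi
  rw [Finset.sum_comm] at h
  have hT0 : contractLeft jm (o : TensorSpace k) G = 0 := by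
    refine eq_zero_of_sum_mul_star (Eq.trans (Finset.sum_congr rfl fun Bm _ => ?_) h)
    simp only [conjTensor_apply, star_star]
    rw [contractLeft, Finset.sum_mul]
    refine Finset.sum_congr rfl fun Bp _ => ?_
    rw [Finset.sum_mul, Finset.sum_mul]
    exact Finset.sum_congr rfl fun A _ => by ring
  rw [hT0, map_zero] at hT
  have := (mul_eq_zero.1 hT.symm).resolve_left h0
  exact Subtype.ext (toPoly_injective (this.trans (map_zero _).symm))

end Contraction

/-! ### Common multidegrees and the three ranges of `γ`. -/

theorem exists_ne_zero_mem_invPoly_smul {n : ℕ} {w : Fin n → ℕ} (hw : Even (∑ i, w i)) {d : ℕ}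
    (hd : d ≠ 0) {F : VecPoly (Fin n)} (hF : F ∈ invPoly (d • w)) (h0 : F ≠ 0) (e : ℕ) :
    ∃ P ∈ invPoly (e • w), P ≠ 0 := by
  obtain ⟨P, hP, hP0⟩ : ∃ P ∈ invPoly w, P ≠ 0 := by
    rw [← Submodule.ne_bot_iff]
    intro h
    have := invPoly_smul_le_pow w hw d hF
    rw [h, ← Submodule.zero_eq_bot, zero_pow hd] at this
    exact h0 this
  exact ⟨P ^ e, pow_mem_invPoly hP e, pow_ne_zero e hP0⟩

/-- In lowest terms the denominator of `r` is prime to its numerator, so it divides every `k i`; the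
quotients form `w`. -/
theorem exists_common_factor {ι : Type*} {r : ℚ} (hr : 0 ≤ r) {k j : ι → ℕ}
    (h : ∀ i, (j i : ℚ) = r * k i) :
    ∃ (d e : ℕ) (w : ι → ℕ), d ≠ 0 ∧ e.Coprime d ∧ r = e / d ∧ k = d • w ∧ j = e • w := by
  have hnum : ((r.num.natAbs : ℕ) : ℚ) = r.num := by
    rw [← Int.cast_natCast, Int.natAbs_of_nonneg (Rat.num_nonneg.2 hr)]
  have hden : (r.den : ℚ) ≠ 0 := by exact_mod_cast r.den_nz
  have hrd : r = (r.num.natAbs : ℕ) / r.den := by rw [hnum, Rat.num_div_den]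
  have key : ∀ i, j i * r.den = r.num.natAbs * k i := fun i => by
    have := h i
    rw [hrd, div_mul_eq_mul_div, eq_div_iff hden] at this
    exact_mod_cast this
  have hdvd : ∀ i, r.den ∣ k i := fun i =>
    r.reduced.symm.dvd_of_dvd_mul_left ⟨j i, by rw [← key i, mul_comm]⟩
  choose w hw using hdvd
  refine ⟨r.den, r.num.natAbs, w, r.den_nz, r.reduced, hrd, funext hw, funext fun i => ?_⟩
  have := key i
  rw [hw i, mul_left_comm, mul_comm] at this
  exact Nat.eq_of_mul_eq_mul_left r.den_pos this

end EPRL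

end

theorem theorem1 (γ : ℚ) (n : ℕ) (k jp jm : Fin n → ℕ)
    (hjp : ∀ i, (jp i : ℚ) / 2 = |1 + γ| / 2 * ((k i : ℚ) / 2))
    (hjm : ∀ i, (jm i : ℚ) / 2 = |1 - γ| / 2 * ((k i : ℚ) / 2))
    (hsum : ∃ s : ℕ, ∑ i, (jp i : ℚ) / 2 = s) :
    Function.Injective (EPRL.eprl k jp jm) := by
  rw [injective_iff_map_eq_zero]
  intro o ho
  by_contra hne
  have hmem := EPRL.toPoly_mem_invPoly.2 o.2
  have hpoly : EPRL.toPoly k o ≠ 0 := fun h =>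
    hne (Subtype.ext (EPRL.toPoly_injective (h.trans (map_zero _).symm)))
  have hk := EPRL.even_of_mem_invPoly hmem hpoly
  obtain ⟨s, hs⟩ := hsum
  have hjs : Even (∑ i, jp i) := by
    rw [← Finset.sum_div, div_eq_iff two_ne_zero] at hs
    exact ⟨s, by rw [← mul_two]; exact_mod_cast hs⟩
  have hjp' : ∀ i, (jp i : ℚ) = |1 + γ| / 2 * k i := fun i => by linarith [hjp i]
  have hjm' : ∀ i, (jm i : ℚ) = |1 - γ| / 2 * k i := fun i => by linarith [hjm i]
  obtain ⟨d, e, w, hd, hcop, hr, rfl, rfl⟩ := EPRL.exists_common_factor (by positivity) hjp'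
  have hd' : (d : ℚ) ≠ 0 := by exact_mod_cast hd
  -- Both `d * ∑ w` and `e * ∑ w` are even, the first because a nonzero `o` exists, the second by
  -- `hsum`. An odd `∑ w` would make `d` and `e` both even.
  have hw : Even (∑ i, w i) := by
    simp only [Pi.smul_apply, smul_eq_mul, ← Finset.mul_sum, Nat.even_mul] at hk hjs
    by_contra hodd
    exact Nat.not_coprime_of_dvd_of_dvd one_lt_two (hjs.resolve_right hodd).two_dvd
      (hk.resolve_right hodd).two_dvd hcop
  have hcase : (|1 + γ| / 2 + |1 - γ| / 2 = 1) ∨ (|1 + γ| / 2 = 1 + |1 - γ| / 2) ∨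
      (|1 - γ| / 2 = 1 + |1 + γ| / 2) := by
    rcases abs_cases (1 + γ) with ⟨h1, _⟩ | ⟨h1, _⟩ <;>
      rcases abs_cases (1 - γ) with ⟨h2, _⟩ | ⟨h2, _⟩ <;> rw [h1, h2]
    · exact Or.inl (by ring)
    · exact Or.inr (Or.inl (by ring))
    · exact Or.inr (Or.inr (by ring))
    · linarith
  rcases hcase with h | h | h
  · have hadd : ∀ i, d * w i = e * w i + jm i := fun i => by
      have h1 := hjp' i
      have h2 := hjm' i
      have h3 : (((d • w) i : ℕ) : ℚ) = ((e • w) i : ℕ) + (jm i : ℕ) := by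
        rw [h1, h2, ← add_mul, h, one_mul]
      exact_mod_cast h3
    have hed : e ≤ d := by
      have : (e : ℚ) / d ≤ 1 := by rw [← hr]; linarith [abs_nonneg (1 - γ)]
      rw [div_le_one (by positivity)] at this
      exact_mod_cast this
    obtain ⟨f, rfl⟩ := Nat.exists_eq_add_of_le hed
    obtain rfl : jm = f • w := funext fun i => by
      have := hadd i
      rw [add_mul] at this
      simpa using (Nat.add_left_cancel this).symm
    refine hne (EPRL.eq_zero_of_eprl_eq_zero_of_add (add_smul e f w) ho ?_)
    -- Of the `e + f` Kempe factors, `e` multiply to an invariant for `jp` and `f` to one for `jm`.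
    refine (EPRL.invPoly_smul_le_pow w hw _).trans ?_
    rw [pow_add]
    exact mul_le_mul' (EPRL.invPoly_pow_le w e) (EPRL.invPoly_pow_le w f)
  · have hadd : ∀ i, e * w i = d * w i + jm i := fun i => by
      have h1 := hjp' i
      have h2 := hjm' i
      have h3 : (((e • w) i : ℕ) : ℚ) = ((d • w) i : ℕ) + (jm i : ℕ) := by
        rw [h1, h2, h, add_mul, one_mul]
      exact_mod_cast h3
    have hde : d ≤ e := by
      have : 1 ≤ (e : ℚ) / d := by rw [← hr]; linarith [abs_nonneg (1 - γ)]
      rw [one_le_div (by positivity)] at this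
      exact_mod_cast this
    obtain ⟨f, rfl⟩ := Nat.exists_eq_add_of_le hde
    obtain rfl : jm = f • w := funext fun i => by
      have := hadd i
      rw [add_mul] at this
      simpa using (Nat.add_left_cancel this).symm
    obtain ⟨P, hP, hP0⟩ := EPRL.exists_ne_zero_mem_invPoly_smul hw hd hmem hpoly f
    exact hne (EPRL.eq_zero_of_eprl_eq_zero_of_left (add_smul d f w) ho hP hP0)
  · obtain rfl : jm = d • w + e • w := funext fun i => by
      have h1 := hjp' i
      have h2 := hjm' i
      have h3 : (jm i : ℚ) = ((d • w) i : ℕ) + ((e • w) i : ℕ) := by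
        rw [h1, h2, h, add_mul, one_mul]
      exact_mod_cast h3
    obtain ⟨P, hP, hP0⟩ := EPRL.exists_ne_zero_mem_invPoly_smul hw hd hmem hpoly e
    exact hne (EPRL.eq_zero_of_eprl_eq_zero_of_right rfl ho hP hP0)
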